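/- Fix $d\ge 2$ and let $\mathcal H(n,d)=(\mathbb C^d)^{\otimes n}$ be the state space of $n\ge 2$ qudits, with start state $|0\rangle=|00\ldots0\rangle$. An architecture is a simple graph $G$ on the $n$ qudits. Its gates are the unitaries that act as an arbitrary element of $U(d^2)$ on two qudits joined by an edge of $G$ and as the identity on all the others. For a unitary $U\in U(d^n)$ let $\ell_G(U)$ be the least length of a product of gates of $G$ that equals $U$. For a unit vector $\psi\in\mathcal H(n,d)$ let $\ell_G(\psi)$ be the least length of a product $W$ of gates of $G$ with $W|0\rangle=\psi$. (No ancilla qudits are used; the value is $\infty$ if there is no such product.) The qudit chain is the path graph on the $n$ qudits. There are constants $0<c$ and $C$, depending only on $d$, such that for every $n\ge2$ and every architecture $G$ that contains the chain as a spanning subgraph (up to the numbering of the qudits), in particular for the chain itself: 1. (State synthesis requires $\Theta(d^n)$ gates.) $\ell_G(\psi)\le C\,d^n$ for every unit vector $\psi$, and $\ell_G(\psi)\ge c\,d^n$ for almost every unit vector $\psi$ with respect to the surface measure of the unit sphere of $\mathcal H(n,d)$. 2. (Generic unitaries require $\Theta(d^{2n})$ gates.) $\ell_G(U)\le C\,d^{2n}$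 for every $U\in U(d^n)$, and $\ell_G(U)\ge c\,d^{2n}$ for almost every $U\in U(d^n)$ with respect to Haar measure. Moreover, define the $\clubsuit$-sequence for $(d,n)$ recursively: it is empty for $n=0$, and for $n\ge1$ it consists, for $q=0,1,\ldots,d-1$ in turn, of the terms of the sequence for $(d,n-1)$ prefixed by the letter $q$, followed by the term $\clubsuit^n$. Each term specifies a one-qudit operation whose target is the position $\ell$ of its leftmost $\clubsuit$ and whose control is the position $q$ of its rightmost digit greater than $0$; the operation is uncontrolled if there is no such digit. The length of the operation is the distance $|\ell-q|$, and $0$ if it is uncontrolled. Let $a(d,n,k)$ be the number of terms of the sequence for $(d,n)$ whose operation has length $k$. Then: 3. $a(d,n,0)=n$ for all $n \ge 0$; $a(d,n,k)=d^{\,n-k}-1$ for $1\le k\le n-1$; $a(d,n,k)=0$ for $k\ge n$; and there is a constant $K$ depending only on $d$ such that $\sum_{k=0}^{n-1}k\,a(d,n,k)\le K\,d^n$ for all $n\ge 0$. -/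

import Mathlib

open MeasureTheory
open scoped NNReal ENNReal Matrix

namespace QuditChain

/-! ### Qudit circuits on an architecture -/

/-- The labels `c₁c₂…cₙ` of the computational basis of `n` qudits with `d` levels each. -/
abbrev Idx (n d : ℕ) : Type := Fin n → Fin d

/-- The `n`-qudit state space: `ℂ^(d^n)` with its Hermitian inner product, the computational
basis being orthonormal. -/
abbrev StateSpace (n d : ℕ) : Type := EuclideanSpace ℂ (Idx n d)

/-- The operator on `n` qudits that applies the two-qudit operator `g` to the qudits `i`, `j`
and the identity to all the others. -/
def twoQuditOp {n d : ℕ} (i j : Fin n) (g : Matrix (Fin d × Fin d) (Fin d × Fin d) ℂ) :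
    Matrix (Idx n d) (Idx n d) ℂ :=
  Matrix.of fun x y =>
    if ∀ v, v ≠ i → v ≠ j → x v = y v then g (x i, x j) (y i, y j) else 0

/-- A two-qudit gate of the architecture `G`: an arbitrary `d² × d²` unitary applied to two qudits
that are joined by an edge of `G`. -/
structure Gate {n : ℕ} (G : SimpleGraph (Fin n)) (d : ℕ) where
  /-- the first qudit -/
  fst : Fin n
  /-- the second qudit -/
  snd : Fin n
  adj : G.Adj fst snd
  /-- the two-qudit unitary -/
  op : Matrix.unitaryGroup (Fin d × Fin d) ℂ

/-- The operator of a gate on all `n` qudits. -/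
def Gate.toMatrix {n d : ℕ} {G : SimpleGraph (Fin n)} (g : Gate G d) :
    Matrix (Idx n d) (Idx n d) ℂ :=
  twoQuditOp g.fst g.snd (g.op : Matrix (Fin d × Fin d) (Fin d × Fin d) ℂ)

/-- A circuit (without ancillas): a finite list of gates, the last one being applied first. Its size
is the length of the list. -/
abbrev Circuit {n : ℕ} (G : SimpleGraph (Fin n)) (d : ℕ) : Type := List (Gate G d)

/-- The operator that a circuit realizes. -/
def Circuit.toMatrix {n d : ℕ} {G : SimpleGraph (Fin n)} (c : Circuit G d) :
    Matrix (Idx n d) (Idx n d) ℂ :=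
  (List.map Gate.toMatrix c).prod

/-- The coordinates of the start state `|00…0⟩`. -/
def zeroKet (n d : ℕ) : Idx n d → ℂ :=
  fun x => if ∀ i, (x i).val = 0 then 1 else 0

/-- The least number of gates of the architecture `G` in a circuit that realizes `U` exactly
(`⊤` if there is no such circuit). -/
noncomputable def unitaryComplexity {n d : ℕ} (G : SimpleGraph (Fin n))
    (U : Matrix.unitaryGroup (Idx n d) ℂ) : ℕ∞ :=
  ⨅ (c : Circuit G d) (_ : c.toMatrix = (U : Matrix (Idx n d) (Idx n d) ℂ)), (c.length : ℕ∞)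

/-- The least number of gates of the architecture `G` in a circuit that maps `|00…0⟩` to the unit
vector `ψ` (`⊤` if there is no such circuit). -/
noncomputable def stateComplexity {n d : ℕ} (G : SimpleGraph (Fin n))
    (ψ : Metric.sphere (0 : StateSpace n d) 1) : ℕ∞ :=
  ⨅ (c : Circuit G d) (_ : c.toMatrix *ᵥ zeroKet n d = (ψ : StateSpace n d).ofLp),
    (c.length : ℕ∞)

/-! ### The measures with respect to which states and unitaries are generic -/

noncomputable instance instMeasurableSpaceUnitary (n d : ℕ) :
    MeasurableSpace (Matrix.unitaryGroup (Idx n d) ℂ) := borel _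

instance instBorelSpaceUnitary (n d : ℕ) : BorelSpace (Matrix.unitaryGroup (Idx n d) ℂ) := ⟨rfl⟩

noncomputable instance instCompactSpaceUnitary (n d : ℕ) :
    CompactSpace (Matrix.unitaryGroup (Idx n d) ℂ) := by
  refine isCompact_iff_compactSpace.mp ?_
  have hK : IsCompact (Set.univ.pi fun _ : Idx n d => Set.univ.pi fun _ : Idx n d =>
      Metric.closedBall (0 : ℂ) 1) :=
    isCompact_univ_pi fun _ => isCompact_univ_pi fun _ => isCompact_closedBall 0 1
  refine IsCompact.of_isClosed_subset hK
    (isClosed_unitary (R := Matrix (Idx n d) (Idx n d) ℂ)) ?_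
  intro U hU i _ j _
  simpa using entry_norm_bound_of_unitary hU i j

/-- The Haar measure of the unitary group `U(d^n)` of the `n`-qudit state space, with total
mass `1`. -/
noncomputable def haarUnitary (n d : ℕ) : Measure (Matrix.unitaryGroup (Idx n d) ℂ) :=
  Measure.haarMeasure ⊤

/-- The surface measure of the unit sphere of the `n`-qudit state space. -/
noncomputable def sphereMeasure (n d : ℕ) : Measure (Metric.sphere (0 : StateSpace n d) 1) :=
  (volume : Measure (StateSpace n d)).toSphere

/-! ### The `♣`-sequence -/

/-- A letter is a digit of `{0, …, d-1}` or `♣`, which is coded as `none`. -/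
abbrev ClubLetter (d : ℕ) : Type := Option (Fin d)

/-- The `♣`-sequence: for each digit `q` in turn the terms of the previous sequence prefixed by `q`,
and then the term `♣♣…♣`. -/
def clubSeq (d : ℕ) : ℕ → List (List (ClubLetter d))
  | 0 => []
  | n + 1 =>
      ((List.finRange d).flatMap fun q => (clubSeq d n).map fun t => some q :: t) ++
        [List.replicate (n + 1) none]

/-- The target of the controlled one-qudit operation given by a term: the position of its
leftmost `♣`. -/
def clubTarget {d : ℕ} (t : List (ClubLetter d)) : ℕ :=
  t.findIdx Option.isNone

/-- Whether a letter is a digit greater than `0`. -/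
def isPosDigit {d : ℕ} : ClubLetter d → Bool
  | none => false
  | some a => decide (0 < a.val)

/-- The control of the operation given by a term: the position of the rightmost digit greater
than `0`. If there is no such digit, the operation is uncontrolled. -/
def clubControl {d : ℕ} (t : List (ClubLetter d)) : Option ℕ :=
  ((List.range t.length).filter fun q => (t[q]?).any isPosDigit).getLast?

/-- The length of the operation given by a term: the distance on the chain between control and
target, and `0` for an uncontrolled operation. -/
def clubLength {d : ℕ} (t : List (ClubLetter d)) : ℕ :=
  match clubControl t with
  | none => 0
  | some q => Nat.dist (clubTarget t) q

/-- `a(d,n,k)`: the number of operations of length `k` specified by the `♣`-sequence; for `k ≥ 1`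
they are singly controlled. -/
def clubCount (d n k : ℕ) : ℕ :=
  (clubSeq d n).countP fun t => clubLength t = k

end QuditChain

namespace QuditChain

/-! ### Counting the operations of the `♣`-sequence -/

/-! States, upper bound. It suffices to send `ψ` to a multiple of the start state, since circuits
can be inverted and a global phase is one gate. Recursively on the last `k` qudits, treat the values
`0, …, d-1` of the first of them in turn. For each value, the recursive operator clears the
remaining digits in the corresponding slice of the current state; one operation on the first qudit
then finishes. Slices already treated must not be spoiled. The key point is that such an operator
consists of `k` free one-qudit operations and of circuits that fix every state whose remaining
digits are zero. Hence only the `k` free operations need a control, and a single one suffices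
(`IsClub.exists_controlled`). Along the chain a control costs linearly many gates in the distance,
by swaps, so the cost satisfies `C (k+1) = d * C k + O(d k²)`, which is `O(d^k)` (`clubCost_le`,
`exists_isClub`).

Unitaries, upper bound. A unitary on dimension `d^n` is a product of at most `d^n` complex
reflections (`exists_list_isReflection`). Each is conjugate, by a circuit preparing its axis, to a
phase on the start state. That phase also costs `O(d^n)` gates (`cost_zeroPhase`). Containing the
chain up to numbering only permutes the basis.

Lower bounds. For a fixed sequence of pairs of qudits, circuits of `m` gates lie in the image of a
polynomial map with `2 m d^4` real parameters; unitarity of the gates is dropped so that the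
parameter space is linear. A `C¹` image of a space of smaller dimension is null, and there are only
countably many sequences of pairs. For states, a radial parameter turns the sphere into its ambient
space. For unitaries, a Hermitian left factor does the same: polar decomposition, Fubini and
invariance of Haar measure carry nullity from all matrices back to the group
(`ae_opProduct_ne_unitary`).

The counts `a(d,n,k)` follow from a recursion in `n`: a prefixed digit shifts target and control
together, and only a positive digit before an uncontrolled term creates a new control. -/

theorem clubTarget_cons {d : ℕ} (q : Fin d) (t : List (ClubLetter d)) :
    clubTarget (some q :: t) = clubTarget t + 1 := by
  simp [clubTarget, List.findIdx_cons]

/-- The control is the rightmost positive digit, so the new first letter matters only if `t` has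
none. -/
theorem clubControl_cons {d : ℕ} (q : Fin d) (t : List (ClubLetter d)) :
    clubControl (some q :: t) =
      match clubControl t with
      | some j => some (j + 1)
      | none => if 0 < q.val then some 0 else none := by
  have h : (List.range (some q :: t).length).filter
        (fun p => ((some q :: t)[p]?).any isPosDigit) =
      (if 0 < q.val then [0] else []) ++
        ((List.range t.length).filter fun p => (t[p]?).any isPosDigit).map Nat.succ := by
    rw [List.length_cons, List.range_succ_eq_map, List.filter_cons, List.filter_map]
    have : ((fun p => ((some q :: t)[p]?).any isPosDigit) ∘ Nat.succ) =
        fun p => (t[p]?).any isPosDigit := by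
      funext p; simp
    rw [this]
    by_cases hq : 0 < q.val <;> simp [isPosDigit, hq]
  rw [clubControl, h, List.getLast?_append, List.getLast?_map]
  rw [← clubControl]
  cases clubControl t with
  | some j => simp
  | none => by_cases hq : 0 < q.val <;> simp [hq]

theorem clubControl_replicate_none (d n : ℕ) :
    clubControl (List.replicate n (none : ClubLetter d)) = none := by
  rw [clubControl, List.getLast?_eq_none_iff, List.filter_eq_nil_iff]
  intro a ha
  simp only [List.length_replicate, List.mem_range] at ha
  simp [ha, isPosDigit]

theorem clubTarget_replicate_none (d n : ℕ) :
    clubTarget (List.replicate (n + 1) (none : ClubLetter d)) = 0 := by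
  simp [clubTarget, List.replicate_succ, List.findIdx_cons]

/-- The number of uncontrolled terms with target `j`. -/
def freeCount (d n j : ℕ) : ℕ :=
  (clubSeq d n).countP fun t => clubControl t = none ∧ clubTarget t = j

/-- The number of uncontrolled terms. -/
def allFreeCount (d n : ℕ) : ℕ :=
  (clubSeq d n).countP fun t => clubControl t = none

/-- The number of controlled terms of length `k`. -/
def ctrlCount (d n k : ℕ) : ℕ :=
  (clubSeq d n).countP fun t => clubControl t ≠ none ∧ clubLength t = k

theorem countP_clubSeq_succ (e n : ℕ) (p : List (ClubLetter (e + 1)) → Bool) :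
    (clubSeq (e + 1) (n + 1)).countP p =
      (clubSeq (e + 1) n).countP (fun t => p (some 0 :: t)) +
        ∑ q : Fin e, (clubSeq (e + 1) n).countP (fun t => p (some q.succ :: t)) +
        if p (List.replicate (n + 1) none) then 1 else 0 := by
  rw [clubSeq, List.countP_append, List.countP_flatMap, ← Fin.sum_univ_def, Fin.sum_univ_succ]
  simp only [List.countP_map, Function.comp_def, List.countP_singleton]

theorem freeCount_succ_succ (e n j : ℕ) :
    freeCount (e + 1) (n + 1) (j + 1) = freeCount (e + 1) n j := by
  have h0 : ∀ t : List (ClubLetter (e + 1)),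
      (clubControl (some 0 :: t) = none ∧ clubTarget (some 0 :: t) = j + 1) ↔
        (clubControl t = none ∧ clubTarget t = j) := by
    intro t
    rw [clubControl_cons, clubTarget_cons]
    cases clubControl t <;> simp
  have h1 : ∀ (q : Fin e) (t : List (ClubLetter (e + 1))),
      ¬ (clubControl (some q.succ :: t) = none ∧ clubTarget (some q.succ :: t) = j + 1) := by
    intro q t
    rw [clubControl_cons]
    cases clubControl t <;> simp
  rw [freeCount, countP_clubSeq_succ]
  simp only [h0, h1, clubTarget_replicate_none]
  simp [freeCount]

theorem freeCount_succ_zero (e n : ℕ) : freeCount (e + 1) (n + 1) 0 = 1 := by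
  rw [freeCount, countP_clubSeq_succ]
  simp only [clubTarget_cons, clubTarget_replicate_none, clubControl_replicate_none]
  simp

/-- The uncontrolled terms are those of the form `0…0♣…♣`, and the target is the number of zeros. -/
theorem freeCount_eq (e n j : ℕ) : freeCount (e + 1) n j = if j < n then 1 else 0 := by
  induction n generalizing j with
  | zero => simp [freeCount, clubSeq]
  | succ n ih =>
    cases j with
    | zero => simp [freeCount_succ_zero]
    | succ j => rw [freeCount_succ_succ, ih]; simp

theorem allFreeCount_eq (e n : ℕ) : allFreeCount (e + 1) n = n := by
  induction n with
  | zero => simp [allFreeCount, clubSeq]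
  | succ n ih =>
    have h0 : ∀ t : List (ClubLetter (e + 1)),
        clubControl (some 0 :: t) = none ↔ clubControl t = none := by
      intro t
      rw [clubControl_cons]
      cases clubControl t <;> simp
    have h1 : ∀ (q : Fin e) (t : List (ClubLetter (e + 1))),
        ¬ clubControl (some q.succ :: t) = none := by
      intro q t
      rw [clubControl_cons]
      cases clubControl t <;> simp
    rw [allFreeCount, countP_clubSeq_succ]
    simp only [h0, h1, clubControl_replicate_none]
    rw [allFreeCount] at ih
    simp [ih]

theorem clubLength_of_control_none {d : ℕ} {t : List (ClubLetter d)} (h : clubControl t = none) :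
    clubLength t = 0 := by
  simp [clubLength, h]

/-- Every prefix preserves the length of a controlled term. A positive prefix turns the free term
with target `j` into a controlled one of length `j + 1`; each of the `e` positive digits thus adds
one term for every length from `1` to `n`. -/
theorem ctrlCount_succ (e n k : ℕ) :
    ctrlCount (e + 1) (n + 1) k =
      (e + 1) * ctrlCount (e + 1) n k + e * (if 1 ≤ k ∧ k ≤ n then 1 else 0) := by
  have h0 : ∀ t : List (ClubLetter (e + 1)),
      (clubControl (some 0 :: t) ≠ none ∧ clubLength (some 0 :: t) = k) ↔
        (clubControl t ≠ none ∧ clubLength t = k) := by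
    intro t
    rw [clubLength, clubLength, clubControl_cons, clubTarget_cons]
    cases clubControl t <;> simp [Nat.dist_succ_succ]
  have h1 : ∀ (q : Fin e) (t : List (ClubLetter (e + 1))),
      (clubControl (some q.succ :: t) ≠ none ∧ clubLength (some q.succ :: t) = k) ↔
        ((clubControl t ≠ none ∧ clubLength t = k) ∨
          (clubControl t = none ∧ clubTarget t + 1 = k)) := by
    intro q t
    rw [clubLength, clubLength, clubControl_cons, clubTarget_cons]
    cases clubControl t <;> simp [Nat.dist]
  have h2 : ∀ l : List (List (ClubLetter (e + 1))),
      l.countP (fun t => ((clubControl t ≠ none ∧ clubLength t = k) ∨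
          (clubControl t = none ∧ clubTarget t + 1 = k))) =
        l.countP (fun t => clubControl t ≠ none ∧ clubLength t = k) +
          l.countP (fun t => clubControl t = none ∧ clubTarget t + 1 = k) := by
    intro l
    induction l with
    | nil => simp
    | cons t l ih =>
      simp only [List.countP_cons, ih]
      by_cases hc : clubControl t = none <;> simp [hc] <;> ring
  have h3 : (clubSeq (e + 1) n).countP (fun t => clubControl t = none ∧ clubTarget t + 1 = k) =
      if 1 ≤ k ∧ k ≤ n then 1 else 0 := by
    cases k with
    | zero => simp
    | succ k =>
      have := freeCount_eq e n k
      rw [freeCount] at this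
      simp only [Nat.add_right_cancel_iff, this]
      simp
  rw [ctrlCount, countP_clubSeq_succ]
  simp only [h0, h1, h2, h3, clubControl_replicate_none]
  rw [← ctrlCount]
  simp only [Finset.sum_const, Finset.card_univ, Fintype.card_fin, smul_eq_mul]
  split_ifs <;> simp_all <;> ring

theorem ctrlCount_eq (e n k : ℕ) :
    ctrlCount (e + 1) n k = if 1 ≤ k ∧ k < n then (e + 1) ^ (n - k) - 1 else 0 := by
  induction n with
  | zero => simp [ctrlCount, clubSeq]
  | succ n ih =>
    rw [ctrlCount_succ, ih]
    by_cases hk : 1 ≤ k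
    · rcases lt_trichotomy k n with h | h | h
      · have h' : n + 1 - k = (n - k) + 1 := by omega
        have hp : 1 ≤ (e + 1) ^ (n - k) := Nat.one_le_pow _ _ (by omega)
        obtain ⟨m, hm⟩ := Nat.exists_eq_add_of_le hp
        rw [if_pos ⟨hk, h⟩, if_pos ⟨hk, h.le⟩, if_pos ⟨hk, by omega⟩, h', pow_succ, hm]
        have : (1 + m) * (e + 1) = (e + 1) * m + e + 1 := by ring
        rw [this]
        simp
      · subst h
        simp [hk]
      · rw [if_neg (by omega), if_neg (by omega), if_neg (by omega)]; simp
    · simp [hk]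

theorem clubCount_eq (e n k : ℕ) :
    clubCount (e + 1) n k = ctrlCount (e + 1) n k + if k = 0 then n else 0 := by
  have h : ∀ l : List (List (ClubLetter (e + 1))),
      l.countP (fun t => clubLength t = k) =
        l.countP (fun t => clubControl t ≠ none ∧ clubLength t = k) +
          if k = 0 then l.countP (fun t => clubControl t = none) else 0 := by
    intro l
    induction l with
    | nil => simp
    | cons t l ih =>
      simp only [List.countP_cons, ih]
      by_cases hc : clubControl t = none
      · rw [clubLength_of_control_none hc]
        by_cases hk : k = 0
        · simp [hc, hk, add_assoc]
        · simp [hc, hk, Ne.symm hk]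
      · by_cases hk : k = 0
        · simp [hc, hk]; ring
        · simp [hc, hk]
  have := allFreeCount_eq e n
  rw [allFreeCount] at this
  rw [clubCount, h, ctrlCount, this]

/-- The slack `2 * n + 2` makes the induction close; for `d = 2` it is an equality. -/
theorem sum_mul_pow_sub_le {d : ℕ} (hd : 2 ≤ d) (n : ℕ) :
    (∑ k ∈ Finset.range n, k * d ^ (n - k)) + 2 * n + 2 ≤ 2 * d ^ n := by
  induction n with
  | zero => simp
  | succ n ih =>
    have h : ∑ k ∈ Finset.range n, k * d ^ (n + 1 - k) =
        d * ∑ k ∈ Finset.range n, k * d ^ (n - k) := by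
      rw [Finset.mul_sum]
      refine Finset.sum_congr rfl fun k hk => ?_
      rw [Finset.mem_range] at hk
      rw [Nat.sub_add_comm hk.le, pow_succ]; ring
    rw [Finset.sum_range_succ, h, Nat.add_sub_cancel_left, pow_one, pow_succ]
    have := Nat.mul_le_mul_left d ih
    nlinarith [Nat.mul_le_mul_left n hd]

/-- The numbers `a(d,n,k)` of operations of length `k`. -/
theorem clubCount_formula {d : ℕ} (hd : 2 ≤ d) :
    (∀ n : ℕ, clubCount d n 0 = n) ∧
    (∀ n k : ℕ, 1 ≤ k → k ≤ n - 1 → clubCount d n k = d ^ (n - k) - 1) ∧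
    (∀ n k : ℕ, n ≤ k → clubCount d n k = 0) ∧
    (∃ K : ℕ, ∀ n : ℕ, ∑ k ∈ Finset.range n, k * clubCount d n k ≤ K * d ^ n) := by
  obtain ⟨e, rfl⟩ : ∃ e, d = e + 1 := ⟨d - 1, by omega⟩
  refine ⟨fun n => ?_, fun n k h1 h2 => ?_, fun n k h => ?_, 2, fun n => ?_⟩
  · simp [clubCount_eq, ctrlCount_eq]
  · rw [clubCount_eq, ctrlCount_eq, if_pos ⟨h1, by omega⟩, if_neg (by omega), add_zero]
  · rw [clubCount_eq, ctrlCount_eq, if_neg (by omega)]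
    split_ifs <;> omega
  · refine le_trans (Finset.sum_le_sum fun k _ => ?_)
      (le_trans (le_trans (Nat.le_add_right _ _) (Nat.le_add_right _ _))
        (sum_mul_pow_sub_le hd n))
    rcases Nat.eq_zero_or_pos k with rfl | hk
    · simp
    · rw [clubCount_eq, if_neg hk.ne', add_zero, ctrlCount_eq]
      gcongr
      split_ifs
      · exact Nat.sub_le _ _
      · exact Nat.zero_le _

/-! ### Gates and circuits as operators on amplitude functions -/

section Gates

variable {n d : ℕ}

theorem twoQuditOp_mulVec {i j : Fin n} (hij : i ≠ j)
    (g : Matrix (Fin d × Fin d) (Fin d × Fin d) ℂ) (ψ : Idx n d → ℂ) (x : Idx n d) :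
    (twoQuditOp i j g *ᵥ ψ) x = ∑ p : Fin d × Fin d,
      g (x i, x j) p * ψ (Function.update (Function.update x i p.1) j p.2) := by
  symm
  refine Fintype.sum_of_injective
    (fun p : Fin d × Fin d => Function.update (Function.update x i p.1) j p.2) ?_ _ _ ?_ ?_
  · intro p q h
    have hi := congrFun h i
    have hj := congrFun h j
    simp [Function.update_of_ne hij] at hi hj
    exact Prod.ext hi hj
  · intro y hy
    dsimp only
    rw [twoQuditOp, Matrix.of_apply, if_neg, zero_mul]
    intro h
    refine hy ⟨(y i, y j), ?_⟩
    funext v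
    by_cases hvj : v = j
    · subst hvj; simp
    · by_cases hvi : v = i
      · subst hvi; simp [hvj]
      · simp [hvi, hvj, h v hvi hvj]
  · intro p
    dsimp only
    rw [twoQuditOp, Matrix.of_apply, if_pos]
    · simp [Function.update_of_ne hij]
    · intro v hi hj
      simp [hi, hj]

theorem matrix_ext_mulVec {ι : Type*} [Fintype ι] [DecidableEq ι] {A B : Matrix ι ι ℂ}
    (h : ∀ ψ, A *ᵥ ψ = B *ᵥ ψ) : A = B :=
  Matrix.toLin'.injective (LinearMap.ext fun ψ => by simpa using h ψ)

theorem twoQuditOp_mul {i j : Fin n} (hij : i ≠ j)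
    (g h : Matrix (Fin d × Fin d) (Fin d × Fin d) ℂ) :
    twoQuditOp i j (g * h) = twoQuditOp i j g * twoQuditOp i j h := by
  refine matrix_ext_mulVec fun ψ => ?_
  rw [← Matrix.mulVec_mulVec]
  funext x
  simp only [twoQuditOp_mulVec hij, Matrix.mul_apply, Finset.sum_mul, Finset.mul_sum]
  rw [Finset.sum_comm]
  refine Finset.sum_congr rfl fun p _ => Finset.sum_congr rfl fun q _ => ?_
  have : Function.update (Function.update (Function.update (Function.update x i p.1) j p.2) i q.1)
      j q.2 = Function.update (Function.update x i q.1) j q.2 := by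
    rw [Function.update_comm hij, Function.update_idem, Function.update_comm hij.symm,
      Function.update_idem]
  simp [Function.update_of_ne hij, this, mul_assoc]

theorem twoQuditOp_one {i j : Fin n} (hij : i ≠ j) :
    twoQuditOp (d := d) i j 1 = 1 := by
  refine matrix_ext_mulVec fun ψ => ?_
  funext x
  rw [twoQuditOp_mulVec hij, Finset.sum_eq_single (x i, x j)]
  · simp
  · intro p _ hp
    simp [hp.symm]
  · simp

theorem twoQuditOp_conjTranspose (i j : Fin n)
    (g : Matrix (Fin d × Fin d) (Fin d × Fin d) ℂ) :
    (twoQuditOp i j g)ᴴ = twoQuditOp i j gᴴ := by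
  ext x y
  simp only [twoQuditOp, Matrix.conjTranspose_apply, Matrix.of_apply, apply_ite star, star_zero]
  simp only [eq_comm]

theorem twoQuditOp_mem_unitaryGroup {i j : Fin n} (hij : i ≠ j)
    {g : Matrix (Fin d × Fin d) (Fin d × Fin d) ℂ}
    (hg : g ∈ Matrix.unitaryGroup (Fin d × Fin d) ℂ) :
    twoQuditOp i j g ∈ Matrix.unitaryGroup (Idx n d) ℂ := by
  rw [Matrix.mem_unitaryGroup_iff, Matrix.star_eq_conjTranspose] at *
  rw [twoQuditOp_conjTranspose, ← twoQuditOp_mul hij, hg, twoQuditOp_one hij]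

variable {G : SimpleGraph (Fin n)}

theorem Circuit.toMatrix_append (c c' : Circuit G d) :
    Circuit.toMatrix (c ++ c') = c.toMatrix * c'.toMatrix := by
  simp [Circuit.toMatrix]

theorem Circuit.toMatrix_cons (g : Gate G d) (c : Circuit G d) :
    Circuit.toMatrix (g :: c) = g.toMatrix * c.toMatrix := by
  simp [Circuit.toMatrix]

theorem Circuit.toMatrix_nil : Circuit.toMatrix ([] : Circuit G d) = 1 := rfl

theorem Circuit.toMatrix_mem_unitaryGroup (c : Circuit G d) :
    c.toMatrix ∈ Matrix.unitaryGroup (Idx n d) ℂ := by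
  refine Submonoid.list_prod_mem _ fun A hA => ?_
  obtain ⟨g, -, rfl⟩ := List.mem_map.mp hA
  exact twoQuditOp_mem_unitaryGroup g.adj.ne g.op.2

/-- The circuit that realizes the inverse operator. -/
theorem Circuit.exists_inverse (c : Circuit G d) :
    ∃ c' : Circuit G d, c'.length = c.length ∧ c'.toMatrix = c.toMatrixᴴ := by
  induction c with
  | nil => exact ⟨[], rfl, by simp [Circuit.toMatrix_nil]⟩
  | cons g c ih =>
    obtain ⟨c', h, h'⟩ := ih
    refine ⟨c' ++ [⟨g.fst, g.snd, g.adj, star g.op⟩], by simp [h], ?_⟩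
    rw [Circuit.toMatrix_append, Circuit.toMatrix_cons g c, Matrix.conjTranspose_mul, h',
      Circuit.toMatrix_cons, Circuit.toMatrix_nil, mul_one, Gate.toMatrix, Gate.toMatrix,
      twoQuditOp_conjTranspose]
    rfl

/-- The operator `F` is realized by a circuit of at most `m` gates. -/
def Cost (G : SimpleGraph (Fin n)) (F : (Idx n d → ℂ) → (Idx n d → ℂ)) (m : ℕ) : Prop :=
  ∃ c : Circuit G d, c.length ≤ m ∧ ∀ ψ, c.toMatrix *ᵥ ψ = F ψ

theorem Cost.mono {F : (Idx n d → ℂ) → (Idx n d → ℂ)} {m m' : ℕ} (h : Cost G F m)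
    (hm : m ≤ m') : Cost G F m' :=
  let ⟨c, hc, hF⟩ := h
  ⟨c, hc.trans hm, hF⟩

theorem Cost.id : Cost G (fun ψ : Idx n d → ℂ => ψ) 0 :=
  ⟨[], le_rfl, fun ψ => by simp [Circuit.toMatrix_nil]⟩

theorem Cost.comp {F F' : (Idx n d → ℂ) → (Idx n d → ℂ)} {m m' : ℕ} (h : Cost G F m)
    (h' : Cost G F' m') : Cost G (fun ψ => F (F' ψ)) (m + m') := by
  obtain ⟨c, hc, hF⟩ := h
  obtain ⟨c', hc', hF'⟩ := h'
  refine ⟨c ++ c', by simpa using add_le_add hc hc', fun ψ => ?_⟩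
  rw [Circuit.toMatrix_append, ← Matrix.mulVec_mulVec, hF', hF]

theorem Cost.congr {F F' : (Idx n d → ℂ) → (Idx n d → ℂ)} {m : ℕ} (h : Cost G F m)
    (hF : ∀ ψ x, F' ψ x = F ψ x) : Cost G F' m := by
  rwa [show F' = F from funext fun ψ => funext fun x => hF ψ x]

theorem cost_twoQuditOp {i j : Fin n} (h : G.Adj i j)
    (g : Matrix.unitaryGroup (Fin d × Fin d) ℂ) :
    Cost G (fun ψ => twoQuditOp i j g.1 *ᵥ ψ) 1 :=
  ⟨[⟨i, j, h, g⟩], by simp, fun ψ => by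
    rw [Circuit.toMatrix_cons, Circuit.toMatrix_nil, mul_one]; rfl⟩

/-- The operator that exchanges the qudits `i` and `j`. -/
def swapOp (i j : Fin n) (ψ : Idx n d → ℂ) : Idx n d → ℂ :=
  fun x => ψ (x ∘ Equiv.swap i j)

/-- The operator that applies `W q` to the qudit `t`, where `q` is the digit of the qudit `s`. -/
def muxOp (s t : Fin n) (W : Fin d → Matrix (Fin d) (Fin d) ℂ) (ψ : Idx n d → ℂ) : Idx n d → ℂ :=
  fun x => ∑ b, W (x s) (x t) b * ψ (Function.update x t b)

/-- The operator that applies `W` to the qudit `t`. -/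
def siteOp (t : Fin n) (W : Matrix (Fin d) (Fin d) ℂ) (ψ : Idx n d → ℂ) : Idx n d → ℂ :=
  fun x => ∑ b, W (x t) b * ψ (Function.update x t b)

theorem permMatrix_mem_unitaryGroup {ι : Type*} [Fintype ι] [DecidableEq ι] (σ : Equiv.Perm ι) :
    σ.permMatrix ℂ ∈ Matrix.unitaryGroup ι ℂ := by
  rw [Matrix.mem_unitaryGroup_iff, Matrix.star_eq_conjTranspose, Matrix.conjTranspose_permMatrix,
    ← Matrix.permMatrix_mul]
  simp

theorem update_update_eq_comp_swap {i j : Fin n} (hij : i ≠ j) (x : Idx n d) :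
    Function.update (Function.update x i (x j)) j (x i) = x ∘ Equiv.swap i j := by
  funext v
  by_cases hj : v = j
  · subst hj; simp
  · by_cases hi : v = i
    · subst hi; simp [hj]
    · simp [hi, hj, Equiv.swap_apply_of_ne_of_ne hi hj]

theorem cost_swapOp {i j : Fin n} (h : G.Adj i j) : Cost G (swapOp (d := d) i j) 1 := by
  refine (cost_twoQuditOp h
    ⟨Equiv.Perm.permMatrix ℂ (Equiv.prodComm (Fin d) (Fin d)), permMatrix_mem_unitaryGroup _⟩).congr
      fun ψ x => ?_
  rw [twoQuditOp_mulVec h.ne, swapOp, Finset.sum_eq_single (x j, x i)]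
  · rw [← update_update_eq_comp_swap h.ne]
    simp [Equiv.Perm.permMatrix, PEquiv.toMatrix_apply]
  · intro p _ hp
    simp [Equiv.Perm.permMatrix, PEquiv.toMatrix_apply, hp.symm]
  · simp

theorem blockDiagonal_mem_unitaryGroup {W : Fin d → Matrix (Fin d) (Fin d) ℂ}
    (hW : ∀ q, W q ∈ Matrix.unitaryGroup (Fin d) ℂ) :
    Matrix.blockDiagonal W ∈ Matrix.unitaryGroup (Fin d × Fin d) ℂ := by
  rw [Matrix.mem_unitaryGroup_iff, Matrix.star_eq_conjTranspose,
    Matrix.blockDiagonal_conjTranspose, ← Matrix.blockDiagonal_mul]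
  have : (fun q => W q * (W q)ᴴ) = 1 := by
    funext q
    exact Matrix.mem_unitaryGroup_iff.mp (hW q)
  rw [this, Matrix.blockDiagonal_one]

theorem cost_muxOp_of_adj {s t : Fin n} (h : G.Adj s t) {W : Fin d → Matrix (Fin d) (Fin d) ℂ}
    (hW : ∀ q, W q ∈ Matrix.unitaryGroup (Fin d) ℂ) : Cost G (muxOp s t W) 1 := by
  -- `Matrix.blockDiagonal` has the block index second, so the target must be the first qudit of the
  -- gate.
  refine (cost_twoQuditOp h.symm ⟨_, blockDiagonal_mem_unitaryGroup hW⟩).congr fun ψ x => ?_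
  rw [twoQuditOp_mulVec h.ne.symm, Fintype.sum_prod_type, muxOp]
  refine Finset.sum_congr rfl fun b _ => ?_
  rw [Finset.sum_eq_single (x s)]
  · rw [Function.update_comm h.ne.symm, Function.update_eq_self]
    simp [Matrix.blockDiagonal_apply]
  · intro q _ hq
    simp [Matrix.blockDiagonal_apply, hq.symm]
  · simp

theorem muxOp_step {s t t' : Fin n} (hst : s ≠ t) (hst' : s ≠ t')
    (W : Fin d → Matrix (Fin d) (Fin d) ℂ) (ψ : Idx n d → ℂ) :
    muxOp s t' W ψ = swapOp t t' (muxOp s t W (swapOp t t' ψ)) := by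
  funext x
  simp only [swapOp, muxOp, Function.comp_apply, Equiv.swap_apply_left,
    Equiv.swap_apply_of_ne_of_ne hst hst']
  refine Finset.sum_congr rfl fun b _ => ?_
  congr 2
  funext v
  simp only [Function.comp_apply, Function.update_apply]
  by_cases hv : v = t'
  · simp [hv]
  · have : Equiv.swap t t' v ≠ t := by
      rw [Ne, Equiv.swap_apply_eq_iff]; simpa using hv
    simp [hv, this]

/-- The target is moved next to the control by `k` swaps and back by `k` more, around one gate. -/
theorem cost_muxOp {W : Fin d → Matrix (Fin d) (Fin d) ℂ}
    (hW : ∀ q, W q ∈ Matrix.unitaryGroup (Fin d) ℂ) (k : ℕ) {s t : Fin n}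
    (h : s.val + k + 1 = t.val) :
    Cost (SimpleGraph.pathGraph n) (muxOp s t W) (2 * k + 1) := by
  induction k generalizing t with
  | zero => exact cost_muxOp_of_adj (SimpleGraph.pathGraph_adj.mpr (by omega)) hW
  | succ k ih =>
    let u : Fin n := ⟨t.val - 1, by omega⟩
    have hu : s.val + k + 1 = u.val := by simp [u]; omega
    have hut : (SimpleGraph.pathGraph n).Adj u t :=
      SimpleGraph.pathGraph_adj.mpr (by simp [u]; omega)
    have h1 : s ≠ u := fun e => by rw [← e] at hu; omega
    have h2 : s ≠ t := fun e => by rw [← e] at h; omega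
    refine (((cost_swapOp hut).comp ((ih hu).comp (cost_swapOp hut))).mono (by omega)).congr
      fun ψ x => ?_
    rw [muxOp_step h1 h2]

theorem cost_muxOp_of_lt {W : Fin d → Matrix (Fin d) (Fin d) ℂ}
    (hW : ∀ q, W q ∈ Matrix.unitaryGroup (Fin d) ℂ) {s t : Fin n} (h : s < t) :
    Cost (SimpleGraph.pathGraph n) (muxOp s t W) (2 * (t.val - s.val)) := by
  have h' : s.val < t.val := h
  exact (cost_muxOp hW (t.val - s.val - 1) (by omega)).mono (by omega)

theorem cost_siteOp (hn : 2 ≤ n) (t : Fin n) {W : Matrix (Fin d) (Fin d) ℂ}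
    (hW : W ∈ Matrix.unitaryGroup (Fin d) ℂ) :
    Cost (SimpleGraph.pathGraph n) (siteOp t W) 1 := by
  obtain ⟨s, hs⟩ : ∃ s, (SimpleGraph.pathGraph n).Adj s t := by
    rcases Nat.eq_zero_or_pos t.val with h | h
    · exact ⟨⟨1, by omega⟩, SimpleGraph.pathGraph_adj.mpr (by simp [h])⟩
    · exact ⟨⟨t.val - 1, by omega⟩, SimpleGraph.pathGraph_adj.mpr (by simp; omega)⟩
  exact cost_muxOp_of_adj hs (W := fun _ => W) fun _ => hW

end Gates

/-! ### Complex reflections -/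

section Reflections

variable {ι : Type*} [DecidableEq ι]

/-- The matrix with eigenvalue `z` on `v` and `1` on its orthogonal complement, for a unit
vector `v`. -/
def reflectionMatrix (v : ι → ℂ) (z : ℂ) : Matrix ι ι ℂ :=
  1 + (z - 1) • Matrix.vecMulVec v (star v)

theorem reflectionMatrix_conjTranspose (v : ι → ℂ) (z : ℂ) :
    (reflectionMatrix v z)ᴴ = reflectionMatrix v (star z) := by
  simp [reflectionMatrix, Matrix.conjTranspose_vecMulVec]

variable [Fintype ι]

/-- The identity or a unitary that differs from it on one line. -/
def IsReflection (H : Matrix ι ι ℂ) : Prop :=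
  H = 1 ∨ ∃ (v : ι → ℂ) (z : ℂ), star v ⬝ᵥ v = 1 ∧ star z * z = 1 ∧ H = reflectionMatrix v z

theorem reflectionMatrix_mulVec (v : ι → ℂ) (z : ℂ) (y : ι → ℂ) :
    reflectionMatrix v z *ᵥ y = y + ((z - 1) * (star v ⬝ᵥ y)) • v := by
  rw [reflectionMatrix, Matrix.add_mulVec, Matrix.one_mulVec, Matrix.smul_mulVec,
    Matrix.vecMulVec_mulVec]
  simp [mul_smul]

theorem reflectionMatrix_mem_unitaryGroup {v : ι → ℂ} {z : ℂ} (hv : star v ⬝ᵥ v = 1)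
    (hz : star z * z = 1) : reflectionMatrix v z ∈ Matrix.unitaryGroup ι ℂ := by
  rw [Matrix.mem_unitaryGroup_iff', Matrix.star_eq_conjTranspose, reflectionMatrix_conjTranspose]
  refine matrix_ext_mulVec fun y => ?_
  rw [← Matrix.mulVec_mulVec, reflectionMatrix_mulVec, reflectionMatrix_mulVec, dotProduct_add,
    dotProduct_smul, hv, Matrix.one_mulVec, add_assoc, ← add_smul]
  have : (z - 1) * (star v ⬝ᵥ y) + (star z - 1) * (star v ⬝ᵥ y +
      ((z - 1) * (star v ⬝ᵥ y)) • 1) = 0 := by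
    rw [smul_eq_mul]
    linear_combination (star v ⬝ᵥ y) * hz
  rw [this, zero_smul, add_zero]

theorem IsReflection.mem_unitaryGroup {H : Matrix ι ι ℂ} (h : IsReflection H) :
    H ∈ Matrix.unitaryGroup ι ℂ := by
  obtain rfl | ⟨v, z, hv, hz, rfl⟩ := h
  · exact one_mem _
  · exact reflectionMatrix_mem_unitaryGroup hv hz

theorem IsReflection.conjTranspose {H : Matrix ι ι ℂ} (h : IsReflection H) :
    IsReflection Hᴴ := by
  obtain rfl | ⟨v, z, hv, hz, rfl⟩ := h
  · left; simp
  · refine Or.inr ⟨v, star z, hv, ?_, reflectionMatrix_conjTranspose v z⟩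
    rw [star_star, mul_comm, hz]

open scoped ComplexOrder in
/-- A reflection that maps a vector to a given vector of the same norm. -/
theorem exists_isReflection_mulVec_eq (u w : ι → ℂ) (h : star u ⬝ᵥ u = star w ⬝ᵥ w) :
    ∃ H : Matrix ι ι ℂ, IsReflection H ∧ H *ᵥ u = w ∧
      ∀ y, star u ⬝ᵥ y = 0 → star w ⬝ᵥ y = 0 → H *ᵥ y = y := by
  by_cases huw : u = w
  · exact ⟨1, Or.inl rfl, by simp [huw], fun y _ _ => by simp⟩
  set r := u - w with hr
  have hr0 : r ≠ 0 := sub_ne_zero.mpr huw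
  have hpos : 0 < star r ⬝ᵥ r := Matrix.dotProduct_star_self_pos_iff.mpr hr0
  set N := star r ⬝ᵥ r with hN
  set s := star r ⬝ᵥ u with hs
  have hNs : N = s + star s := by
    have e1 : star s = star u ⬝ᵥ r := by
      rw [hs, Matrix.star_dotProduct, star_star]
    rw [e1, hN, hs, hr]
    simp only [star_sub, sub_dotProduct, dotProduct_sub]
    rw [h]; ring
  obtain ⟨ρ, hρ0, hρ⟩ : ∃ ρ : ℝ, ρ ≠ 0 ∧ (ρ : ℂ) * ρ = N := by
    have hre : (N.re : ℂ) = N := by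
      rw [Complex.pos_iff] at hpos
      exact Complex.ext (by simp) (by simpa using hpos.2)
    have hp : 0 < N.re := (Complex.pos_iff.mp hpos).1
    refine ⟨Real.sqrt N.re, (Real.sqrt_pos.mpr hp).ne', ?_⟩
    rw [← Complex.ofReal_mul, Real.mul_self_sqrt hp.le, hre]
  have hρ0' : (ρ : ℂ) ≠ 0 := by exact_mod_cast hρ0
  have hs0 : s ≠ 0 := by
    intro h0
    rw [h0] at hNs
    simp at hNs
    exact hpos.ne' hNs
  have hs0' : star s ≠ 0 := star_ne_zero.mpr hs0
  have hv : star ((ρ : ℂ)⁻¹ • r) = (ρ : ℂ)⁻¹ • star r := by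
    rw [star_smul]; simp
  -- The axis is `r = u - w`, and the eigenvalue `z` is determined by `(z - 1) * s = -N`, which
  -- makes the correction of `u` equal to `-r`. By `N = s + star s`, this `z` has modulus one.
  refine ⟨reflectionMatrix ((ρ : ℂ)⁻¹ • r) (-(star s) / s),
    Or.inr ⟨_, _, ?_, ?_, rfl⟩, ?_, fun y hu hw => ?_⟩
  · rw [hv, smul_dotProduct, dotProduct_smul, ← hN, ← hρ]
    simp only [smul_eq_mul]
    field_simp
  · rw [star_div₀, star_neg, star_star]
    field_simp
  · rw [reflectionMatrix_mulVec, hv, smul_dotProduct, ← hs, smul_smul]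
    have : (-(star s) / s - 1) * ((ρ : ℂ)⁻¹ • s) * (ρ : ℂ)⁻¹ = -1 := by
      have : (-(star s) / s - 1) * s = -N := by
        rw [hNs]; field_simp; ring
      rw [smul_eq_mul]
      calc _ = ((-(star s) / s - 1) * s) * (ρ : ℂ)⁻¹ * (ρ : ℂ)⁻¹ := by ring
        _ = _ := by rw [this, ← hρ]; field_simp
    rw [this, hr]
    simp
  · rw [reflectionMatrix_mulVec, hv, smul_dotProduct]
    have : star r ⬝ᵥ y = 0 := by rw [hr, star_sub, sub_dotProduct, hu, hw, sub_zero]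
    rw [this]
    simp

theorem star_mulVec_dotProduct_mulVec {U : Matrix ι ι ℂ} (hU : U ∈ Matrix.unitaryGroup ι ℂ)
    (x y : ι → ℂ) : star (U *ᵥ x) ⬝ᵥ (U *ᵥ y) = star x ⬝ᵥ y := by
  rw [Matrix.star_mulVec, Matrix.dotProduct_mulVec, Matrix.vecMul_vecMul,
    ← Matrix.star_eq_conjTranspose, Matrix.mem_unitaryGroup_iff'.mp hU, Matrix.vecMul_one]

/-- A reflection taking `U e_a` back to `e_a` leaves the basis vectors already fixed by `U` alone:
they are orthogonal to `e_a`, hence, `U` being unitary, also to `U e_a`. -/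
theorem exists_list_isReflection_of_fixes (s : Finset ι) {U : Matrix ι ι ℂ}
    (hU : U ∈ Matrix.unitaryGroup ι ℂ)
    (hs : ∀ j ∉ s, U *ᵥ Pi.single j 1 = Pi.single j 1) :
    ∃ L : List (Matrix ι ι ℂ), L.length ≤ s.card ∧ (∀ H ∈ L, IsReflection H) ∧ L.prod = U := by
  induction s using Finset.induction_on generalizing U with
  | empty =>
    refine ⟨[], by simp, by simp, ?_⟩
    ext i j
    have := congrFun (hs j (by simp)) i
    rw [Matrix.mulVec_single_one] at this
    rw [List.prod_nil, Matrix.one_apply]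
    rw [Matrix.col_apply] at this
    rw [this, Pi.single_apply]
  | insert a s ha ih =>
    obtain ⟨H, hH, hHu, hfix⟩ := exists_isReflection_mulVec_eq (U *ᵥ Pi.single a 1)
      (Pi.single a 1) (star_mulVec_dotProduct_mulVec hU _ _)
    have hHU := mul_mem hH.mem_unitaryGroup hU
    obtain ⟨L, hL, hLr, hLU⟩ := ih hHU fun j hj => by
      rw [← Matrix.mulVec_mulVec]
      by_cases hja : j = a
      · rw [hja, hHu]
      · have h0 : star (Pi.single a (1 : ℂ)) ⬝ᵥ Pi.single j (1 : ℂ) = 0 := by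
          rw [dotProduct_single_one, Pi.star_apply, Pi.single_eq_of_ne hja, star_zero]
        have hUj := hs j (by simp [hja, hj])
        rw [hUj]
        refine hfix _ ?_ h0
        conv_lhs => rw [← hUj]
        rw [star_mulVec_dotProduct_mulVec hU, h0]
    refine ⟨Hᴴ :: L, ?_, ?_, ?_⟩
    · rw [Finset.card_insert_of_notMem ha]; simpa using hL
    · intro K hK
      rcases List.mem_cons.mp hK with rfl | hK
      · exact hH.conjTranspose
      · exact hLr K hK
    · rw [List.prod_cons, hLU, ← mul_assoc, ← Matrix.star_eq_conjTranspose,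
        Matrix.mem_unitaryGroup_iff'.mp hH.mem_unitaryGroup, one_mul]

/-- Every unitary is a product of at most as many reflections as the dimension. -/
theorem exists_list_isReflection {U : Matrix ι ι ℂ} (hU : U ∈ Matrix.unitaryGroup ι ℂ) :
    ∃ L : List (Matrix ι ι ℂ), L.length ≤ Fintype.card ι ∧ (∀ H ∈ L, IsReflection H) ∧
      L.prod = U :=
  exists_list_isReflection_of_fixes Finset.univ hU (by simp)

end Reflections

/-! ### State synthesis with singly controlled operations -/

section Synthesis

variable {n d : ℕ}

/-- The digits of `p` before the position `a` and those of `x` from `a` on. -/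
def setPrefix (a : ℕ) (p x : Idx n d) : Idx n d :=
  fun i => if i.val < a then p i else x i

theorem setPrefix_of_lt {a : ℕ} {i : Fin n} (h : i.val < a) (p x : Idx n d) :
    setPrefix a p x i = p i := if_pos h

theorem setPrefix_of_le {a : ℕ} {i : Fin n} (h : a ≤ i.val) (p x : Idx n d) :
    setPrefix a p x i = x i := if_neg h.not_gt

theorem setPrefix_eq {a : ℕ} {p x : Idx n d} (h : ∀ i : Fin n, i.val < a → x i = p i) :
    setPrefix a p x = x := by
  funext i
  by_cases hi : i.val < a
  · rw [setPrefix_of_lt hi, h i hi]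
  · exact setPrefix_of_le (not_lt.mp hi) _ _

theorem setPrefix_congr {a : ℕ} {p p' : Idx n d} (h : ∀ i : Fin n, i.val < a → p i = p' i)
    (x : Idx n d) : setPrefix a p x = setPrefix a p' x := by
  funext i
  by_cases hi : i.val < a
  · rw [setPrefix_of_lt hi, setPrefix_of_lt hi, h i hi]
  · rw [setPrefix_of_le (not_lt.mp hi), setPrefix_of_le (not_lt.mp hi)]

theorem setPrefix_update {a : ℕ} {t : Fin n} (ht : a ≤ t.val) (p x : Idx n d) (b : Fin d) :
    setPrefix a p (Function.update x t b) = Function.update (setPrefix a p x) t b := by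
  funext i
  by_cases hi : i = t
  · subst hi; simp [setPrefix_of_le ht]
  · simp [setPrefix, hi]

/-- The amplitudes with the digits before the position `a` set to those of `p`. -/
def slice (a : ℕ) (p : Idx n d) (ψ : Idx n d → ℂ) : Idx n d → ℂ :=
  fun x => ψ (setPrefix a p x)

/-- The operator acts on the qudits from `a` on only. -/
def IsTail (a : ℕ) (F : (Idx n d → ℂ) → (Idx n d → ℂ)) : Prop :=
  ∀ (b : ℕ) (p : Idx n d) (ψ : Idx n d → ℂ), b ≤ a → F (slice b p ψ) = slice b p (F ψ)

theorem IsTail.mono {a b : ℕ} {F : (Idx n d → ℂ) → (Idx n d → ℂ)} (h : IsTail b F)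
    (hab : a ≤ b) : IsTail a F :=
  fun c p ψ hc => h c p ψ (hc.trans hab)

theorem IsTail.comp {a : ℕ} {F F' : (Idx n d → ℂ) → (Idx n d → ℂ)} (h : IsTail a F)
    (h' : IsTail a F') : IsTail a fun ψ => F (F' ψ) :=
  fun b p ψ hb => by simp only [h' b p ψ hb, h b p _ hb]

theorem isTail_muxOp {a : ℕ} {s t : Fin n} (hs : a ≤ s.val) (ht : a ≤ t.val)
    (W : Fin d → Matrix (Fin d) (Fin d) ℂ) : IsTail a (muxOp s t W) := by
  intro b p ψ hb
  funext x
  simp only [muxOp, slice, setPrefix_update (hb.trans ht), setPrefix_of_le (hb.trans hs),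
    setPrefix_of_le (hb.trans ht)]

theorem isTail_siteOp {a : ℕ} {t : Fin n} (ht : a ≤ t.val) (W : Matrix (Fin d) (Fin d) ℂ) :
    IsTail a (siteOp t W) :=
  isTail_muxOp ht ht fun _ => W

/-- An operator on the qudits from `a` on acts separately on the values of the other digits. -/
theorem IsTail.apply_eq {a : ℕ} {F : (Idx n d → ℂ) → (Idx n d → ℂ)} (h : IsTail a F)
    {ψ φ : Idx n d → ℂ} {x : Idx n d}
    (hψ : ∀ y, (∀ i : Fin n, i.val < a → y i = x i) → ψ y = φ y) : F ψ x = F φ x := by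
  have e : slice a x ψ = slice a x φ :=
    funext fun y => hψ _ fun i hi => setPrefix_of_lt hi _ _
  have key := congrFun (congrArg F e) x
  rw [h a x ψ le_rfl, h a x φ le_rfl] at key
  simpa [slice, setPrefix_eq] using key

variable [NeZero d]

/-- The amplitudes vanish unless the digits of all qudits from `a` on are zero. -/
def ZeroFrom (a : ℕ) (ψ : Idx n d → ℂ) : Prop :=
  ∀ x, ψ x ≠ 0 → ∀ i : Fin n, a ≤ i.val → x i = 0

/-- The operators that are products of `f` one-qudit operations on qudits from `a` on and of
circuits on these qudits that fix the states with zero digits there, with `g` gates in all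
these circuits. -/
inductive IsClub (a : ℕ) : ℕ → ℕ → ((Idx n d → ℂ) → (Idx n d → ℂ)) → Prop
  | id : IsClub a 0 0 fun ψ => ψ
  | free {f g : ℕ} {M : (Idx n d → ℂ) → (Idx n d → ℂ)} (t : Fin n)
      (W : Matrix (Fin d) (Fin d) ℂ) (ht : a ≤ t.val) (hW : W ∈ Matrix.unitaryGroup (Fin d) ℂ)
      (hM : IsClub a f g M) : IsClub a (f + 1) g fun ψ => siteOp t W (M ψ)
  | fix {f g k : ℕ} {M F : (Idx n d → ℂ) → (Idx n d → ℂ)}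
      (hF : Cost (SimpleGraph.pathGraph n) F k) (hFa : IsTail a F)
      (hF0 : ∀ ψ, ZeroFrom a ψ → F ψ = ψ)
      (hM : IsClub a f g M) : IsClub a f (g + k) fun ψ => F (M ψ)

theorem IsClub.isTail {a f g : ℕ} {M : (Idx n d → ℂ) → (Idx n d → ℂ)} (h : IsClub a f g M) :
    IsTail a M := by
  induction h with
  | id => exact fun _ _ _ _ => rfl
  | free t W ht hW hM ih => exact (isTail_siteOp ht W).comp ih
  | fix hF hFa hF0 hM ih => exact hFa.comp ih

theorem ZeroFrom.mono {a b : ℕ} {ψ : Idx n d → ℂ} (h : ZeroFrom a ψ) (hab : a ≤ b) :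
    ZeroFrom b ψ :=
  fun x hx i hi => h x hx i (hab.trans hi)

theorem IsClub.mono {a b f g : ℕ} {M : (Idx n d → ℂ) → (Idx n d → ℂ)} (h : IsClub b f g M)
    (hab : a ≤ b) : IsClub a f g M := by
  induction h with
  | id => exact .id
  | free t W ht hW hM ih => exact .free t W (hab.trans ht) hW ih
  | fix hF hFa hF0 hM ih =>
    exact .fix hF (hFa.mono hab) (fun ψ hψ => hF0 ψ (hψ.mono hab)) ih

theorem IsClub.cost (hn : 2 ≤ n) {a f g : ℕ} {M : (Idx n d → ℂ) → (Idx n d → ℂ)}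
    (h : IsClub a f g M) : Cost (SimpleGraph.pathGraph n) M (f + g) := by
  induction h with
  | id => exact Cost.id
  | free t W ht hW hM ih => exact ((cost_siteOp hn t hW).comp ih).mono (by omega)
  | fix hF hFa hF0 hM ih => exact (hF.comp ih).mono (by omega)

/-- The one-qudit operation `W` on the qudit `t`, controlled by the digit `q` of the qudit `s`. -/
def ctrlOp (s : Fin n) (q : Fin d) (t : Fin n) (W : Matrix (Fin d) (Fin d) ℂ) :
    (Idx n d → ℂ) → (Idx n d → ℂ) :=
  muxOp s t fun p => if p = q then W else 1

omit [NeZero d] in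
theorem siteOp_one (t : Fin n) (ψ : Idx n d → ℂ) : siteOp t 1 ψ = ψ := by
  funext x
  rw [siteOp, Finset.sum_eq_single (x t)]
  · simp
  · intro b _ hb
    simp [Matrix.one_apply_ne hb.symm]
  · simp

omit [NeZero d] in
theorem ctrlOp_apply_of_eq {s t : Fin n} {q : Fin d} {x : Idx n d} (hx : x s = q)
    (W : Matrix (Fin d) (Fin d) ℂ) (ψ : Idx n d → ℂ) :
    ctrlOp s q t W ψ x = siteOp t W ψ x := by
  simp [ctrlOp, muxOp, siteOp, hx]

omit [NeZero d] in
theorem ctrlOp_apply_of_ne {s t : Fin n} {q : Fin d} {x : Idx n d} (hx : x s ≠ q)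
    (W : Matrix (Fin d) (Fin d) ℂ) (ψ : Idx n d → ℂ) :
    ctrlOp s q t W ψ x = ψ x := by
  rw [← congrFun (siteOp_one t ψ) x]
  simp [ctrlOp, muxOp, siteOp, hx]

omit [NeZero d] in
theorem cost_ctrlOp {s t : Fin n} (hst : s < t) (q : Fin d) {W : Matrix (Fin d) (Fin d) ℂ}
    (hW : W ∈ Matrix.unitaryGroup (Fin d) ℂ) :
    Cost (SimpleGraph.pathGraph n) (ctrlOp s q t W) (2 * (t.val - s.val)) := by
  refine cost_muxOp_of_lt (fun p => ?_) hst
  split_ifs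
  · exact hW
  · exact one_mem _

/-- Controlling the uncontrolled operations by a nonzero digit `q` of the first qudit yields a
circuit that acts as before if this digit is `q`, and fixes zero states otherwise. -/
theorem IsClub.exists_controlled {s : Fin n} {q : Fin d} (hq : q ≠ 0) {f g : ℕ}
    {M : (Idx n d → ℂ) → (Idx n d → ℂ)} (h : IsClub (s.val + 1) f g M) :
    ∃ F, Cost (SimpleGraph.pathGraph n) F (g + 2 * (n - s.val) * f) ∧ IsTail s.val F ∧
      (∀ ψ, ZeroFrom s.val ψ → F ψ = ψ) ∧
      (∀ ψ x, x s = q → F ψ x = M ψ x) ∧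
      ∀ ψ x, x s ≠ q → ZeroFrom (s.val + 1) (slice (s.val + 1) x ψ) → F ψ x = ψ x := by
  induction h with
  | id =>
    exact ⟨_, Cost.id.mono (Nat.zero_le _), fun _ _ _ _ => rfl, fun _ _ => rfl, fun _ _ _ => rfl,
      fun _ _ _ _ => rfl⟩
  | @free f g M t W ht hW hM ih =>
    obtain ⟨F, hF, hFa, hF0, hFq, hFq'⟩ := ih
    have hst : s < t := ht
    refine ⟨fun ψ => ctrlOp s q t W (F ψ), ((cost_ctrlOp hst q hW).comp hF).mono ?_,
      (isTail_muxOp le_rfl (by omega) _).comp hFa, fun ψ hψ => ?_, fun ψ x hx => ?_,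
      fun ψ x hx hψ => ?_⟩
    · have : t.val - s.val ≤ n - s.val := by omega
      nlinarith
    · dsimp only
      rw [hF0 ψ hψ]
      funext x
      by_cases hx : x s = q
      · have hz : ∀ y : Idx n d, y s = q → ψ y = 0 := by
          intro y hy
          by_contra h0
          exact hq (hy.symm.trans (hψ y h0 s le_rfl))
        -- The control never fires: `q ≠ 0`, while the qudit `s` carries the digit `0` wherever `ψ`
        -- is nonzero.
        rw [ctrlOp_apply_of_eq hx, siteOp, hz x hx]
        refine Finset.sum_eq_zero fun b _ => ?_
        rw [hz _ (by rw [Function.update_of_ne hst.ne, hx]), mul_zero]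
      · exact ctrlOp_apply_of_ne hx _ _
    · dsimp only
      rw [ctrlOp_apply_of_eq hx]
      exact (isTail_siteOp ht W).apply_eq
        fun y hy => hFq ψ y ((hy s (Nat.lt_succ_self _)).trans hx)
    · dsimp only
      rw [ctrlOp_apply_of_ne hx, hFq' ψ x hx hψ]
  | @fix f g k M F' hF' hFa' hF0' hM ih =>
    obtain ⟨F, hF, hFa, hF0, hFq, hFq'⟩ := ih
    refine ⟨fun ψ => F' (F ψ), (hF'.comp hF).mono (by omega),
      (hFa'.mono (Nat.le_succ _)).comp hFa, fun ψ hψ => ?_, fun ψ x hx => ?_,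
      fun ψ x hx hψ => ?_⟩
    · dsimp only
      rw [hF0 ψ hψ]
      exact hF0' ψ (hψ.mono (Nat.le_succ _))
    · exact hFa'.apply_eq fun y hy => hFq ψ y ((hy s (Nat.lt_succ_self _)).trans hx)
    · dsimp only
      -- At `x` only the slice with the prefix of `x` matters. It has zero tail, so the uncontrolled
      -- circuit fixes it.
      rw [hFa'.apply_eq (φ := slice (s.val + 1) x ψ) (fun y hy => ?_), hF0' _ hψ, slice,
        setPrefix_eq fun _ _ => rfl]
      rw [slice, setPrefix_eq hy, hFq' ψ y (by rwa [hy s (Nat.lt_succ_self _)])]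
      have : slice (s.val + 1) y ψ = slice (s.val + 1) x ψ :=
        funext fun z => congrArg ψ (setPrefix_congr hy z)
      rwa [this]

/-- The number of gates for the controlled operations on `k` qudits. -/
def clubCost (d : ℕ) : ℕ → ℕ
  | 0 => 0
  | k + 1 => d * clubCost d k + d * (2 * (k + 1) * k)

omit [NeZero d] in
-- The quadratic added on the left absorbs the inhomogeneous term `2 d k (k + 1)` of the recursion.
theorem clubCost_le (hd : 2 ≤ d) (k : ℕ) :
    clubCost d k + (4 * k ^ 2 + 16 * k + 24) ≤ 24 * d ^ k := by
  induction k with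
  | zero => simp [clubCost]
  | succ k ih =>
    rw [clubCost, pow_succ d]
    have := Nat.mul_le_mul_left d ih
    nlinarith [Nat.mul_le_mul_right (2 * k ^ 2 + 14 * k + 24) hd]

theorem exists_unitary_mulVec_single (v : Fin d → ℂ) :
    ∃ W ∈ Matrix.unitaryGroup (Fin d) ℂ, ∀ b, b ≠ 0 → (W *ᵥ v) b = 0 := by
  obtain ⟨ρ, hρ⟩ : ∃ ρ : ℝ, (ρ : ℂ) * ρ = star v ⬝ᵥ v := by
    refine ⟨Real.sqrt (∑ b, Complex.normSq (v b)), ?_⟩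
    rw [← Complex.ofReal_mul, Real.mul_self_sqrt (Finset.sum_nonneg fun b _ =>
      Complex.normSq_nonneg _)]
    simp [dotProduct, Complex.normSq_eq_conj_mul_self]
  obtain ⟨H, hH, hHv, -⟩ := exists_isReflection_mulVec_eq v (Pi.single 0 (ρ : ℂ)) (by
    rw [← hρ]; simp)
  exact ⟨H, hH.mem_unitaryGroup, fun b hb => by rw [hHv, Pi.single_eq_of_ne hb]⟩

theorem exists_isClub (k : ℕ) : ∀ (a : ℕ), a + k = n → ∀ ψ : Idx n d → ℂ,
    ∃ M, IsClub a k (clubCost d k) M ∧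
      ∀ x : Idx n d, (∀ i : Fin n, i.val < a → x i = 0) → M ψ x ≠ 0 → ∀ i, x i = 0 := by
  induction k with
  | zero => exact fun a ha ψ => ⟨_, .id, fun x hx _ i => hx i (by omega)⟩
  | succ k ih =>
    intro a ha ψ
    let s : Fin n := ⟨a, by omega⟩
    -- Slices with digit at most `m` at `s` are cleared. The number of free operations stays `k`,
    -- because only the round for the digit `0` is left uncontrolled.
    have inner : ∀ m, m < d → ∃ M, IsClub a k ((m + 1) * clubCost d k + m * (2 * (k + 1) * k)) M ∧
        ∀ x : Idx n d, (∀ i : Fin n, i.val < a → x i = 0) → (x s).val ≤ m → M ψ x ≠ 0 →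
          ∀ i : Fin n, a < i.val → x i = 0 := by
      intro m
      induction m with
      | zero =>
        intro _
        obtain ⟨M, hM, hM0⟩ := ih (a + 1) (by omega) ψ
        refine ⟨M, by simpa using hM.mono (Nat.le_succ a), fun x hx hxs h0 i _ =>
          hM0 x (fun j hj => ?_) h0 i⟩
        rcases Nat.lt_succ_iff_lt_or_eq.mp hj with hj | hj
        · exact hx j hj
        · rw [show j = s from Fin.ext hj]
          exact Fin.ext (by simpa using hxs)
      | succ m ihm =>
        intro hm
        obtain ⟨M, hM, hM0⟩ := ihm (by omega)
        let q : Fin d := ⟨m + 1, hm⟩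
        have hq : q ≠ 0 := fun h => by simpa [q] using congrArg Fin.val h
        -- The earlier rounds may have changed the slice of digit `q`, so the next operator is built
        -- for the current state `M ψ`.
        obtain ⟨N, hN, hN0⟩ := ih (a + 1) (by omega)
          (slice (a + 1) (Function.update 0 s q) (M ψ))
        obtain ⟨F, hF, hFa, hF0, hFq, hFq'⟩ := IsClub.exists_controlled (s := s) hq hN
        have hns : n - s.val = k + 1 := by simp only [s]; omega
        refine ⟨fun ψ => F (M ψ), ?_, fun x hx hxs h0 i hi => ?_⟩
        · have := IsClub.fix hF hFa hF0 hM
          rw [hns] at this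
          convert this using 1
          ring
        · dsimp only at h0
          have hsi : i ≠ s := fun e => by simp [e, s] at hi
          by_cases hxq : x s = q
          · rw [hFq _ x hxq] at h0
            have e : setPrefix (a + 1) (Function.update 0 s q) (Function.update x s 0) = x := by
              funext j
              rcases lt_trichotomy j.val a with hj | hj | hj
              · have : j ≠ s := fun e => by simp [e, s] at hj
                rw [setPrefix_of_lt (by omega), Function.update_of_ne this, hx j hj]
                rfl
              · rw [show j = s from Fin.ext hj, setPrefix_of_lt (by simp [s]),
                  Function.update_self, hxq]
              · have : j ≠ s := fun e => by simp [e, s] at hj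
                rw [setPrefix_of_le (by omega), Function.update_of_ne this]
            have := hN0 (Function.update x s 0) (fun j hj => ?_) ?_ i
            · rwa [Function.update_of_ne hsi] at this
            · by_cases hjs : j = s
              · rw [hjs, Function.update_self]
              · rw [Function.update_of_ne hjs]
                refine hx j ?_
                have : j.val ≠ a := fun e => hjs (Fin.ext e)
                omega
            · rw [hN.isTail _ _ _ le_rfl, slice, e]
              exact h0
          · have hxm : (x s).val ≤ m := by
              have : (x s).val ≠ m + 1 := fun e => hxq (Fin.ext e)
              omega
            rw [hFq' _ x hxq fun y hy j hj => ?_] at h0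
            · exact hM0 x hx hxm h0 i hi
            · have := hM0 (setPrefix (s.val + 1) x y) (fun l hl => ?_) ?_ hy j hj
              · rwa [setPrefix_of_le hj] at this
              · rw [setPrefix_of_lt (hl.trans (Nat.lt_succ_self a)), hx l hl]
              · rwa [setPrefix_of_lt (Nat.lt_succ_self _)]
    have hd : d ≠ 0 := NeZero.ne d
    obtain ⟨M, hM, hM0⟩ := inner (d - 1) (by omega)
    obtain ⟨W, hW, hW0⟩ := exists_unitary_mulVec_single fun b => M ψ (Function.update 0 s b)
    refine ⟨fun ψ => siteOp s W (M ψ), ?_, fun x hx h0 => ?_⟩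
    · have hM' := hM.free s W le_rfl hW
      have hle : (d - 1 + 1) * clubCost d k + (d - 1) * (2 * (k + 1) * k) +
          2 * (k + 1) * k = clubCost d (k + 1) := by
        obtain ⟨e, rfl⟩ := Nat.exists_eq_succ_of_ne_zero hd
        simp only [Nat.succ_eq_add_one, Nat.add_sub_cancel, clubCost]
        ring
      rw [← hle]
      -- `clubCost` charges `d` controlled rounds, but there are `d - 1`; the identity absorbs the
      -- surplus.
      exact .fix (F := fun ψ => ψ) (Cost.id.mono (Nat.zero_le _)) (fun _ _ _ _ => rfl) (fun _ _ => rfl) hM'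
    · have hz : ∀ i : Fin n, a < i.val → x i = 0 := by
        intro i hi
        obtain ⟨b, -, hb⟩ := Finset.exists_ne_zero_of_sum_ne_zero h0
        have hsi : i ≠ s := fun e => by simp [e, s] at hi
        have := hM0 (Function.update x s b) (fun j hj => ?_)
          (Nat.le_sub_one_of_lt (Fin.isLt _)) (right_ne_zero_of_mul hb) i hi
        · rwa [Function.update_of_ne hsi] at this
        · have : j ≠ s := fun e => by simp [e, s] at hj
          rw [Function.update_of_ne this, hx j hj]
      have hx0 : ∀ i : Fin n, i ≠ s → x i = 0 := by
        intro i hi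
        have : i.val ≠ a := fun e => hi (Fin.ext e)
        rcases lt_or_gt_of_ne this with h | h
        · exact hx i h
        · exact hz i h
      have hxs : x s = 0 := by
        by_contra hne
        refine h0 ?_
        rw [← hW0 _ hne]
        refine Finset.sum_congr rfl fun b _ => ?_
        congr 2
        funext i
        by_cases hi : i = s
        · subst hi; simp
        · simp [hi, hx0 i hi]
      intro i
      by_cases hi : i = s
      · rw [hi, hxs]
      · exact hx0 i hi

theorem zeroKet_eq_single : zeroKet n d = Pi.single 0 1 := by
  funext x
  rw [zeroKet, Pi.single_apply]
  exact if_congr ⟨fun h => funext fun i => Fin.ext (by simpa using h i), fun h i => by simp [h]⟩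
    rfl rfl

omit [NeZero d] in
theorem siteOp_smul_one (t : Fin n) (z : ℂ) (ψ : Idx n d → ℂ) :
    siteOp t (z • (1 : Matrix (Fin d) (Fin d) ℂ)) ψ = z • ψ := by
  conv_rhs => rw [← siteOp_one t ψ]
  funext x
  simp [siteOp, Finset.mul_sum, mul_assoc]

omit [NeZero d] in
theorem cost_smul (hn : 2 ≤ n) {z : ℂ} (hz : star z * z = 1) :
    Cost (SimpleGraph.pathGraph n) (fun ψ : Idx n d → ℂ => z • ψ) 1 := by
  refine (cost_siteOp hn ⟨0, by omega⟩ (W := z • (1 : Matrix (Fin d) (Fin d) ℂ)) ?_).congr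
    fun ψ x => ?_
  · rw [Matrix.mem_unitaryGroup_iff', Matrix.star_eq_conjTranspose, Matrix.conjTranspose_smul,
      Matrix.conjTranspose_one, smul_mul_smul_comm, hz, one_smul, mul_one]
  · rw [siteOp_smul_one]

/-- State synthesis on the chain. -/
theorem exists_circuit_mulVec_zeroKet (hn : 2 ≤ n) (hd : 2 ≤ d) (v : Idx n d → ℂ)
    (hv : star v ⬝ᵥ v = 1) :
    ∃ c : Circuit (SimpleGraph.pathGraph n) d, c.length ≤ 25 * d ^ n ∧
      c.toMatrix *ᵥ zeroKet n d = v := by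
  obtain ⟨M, hM, hM0⟩ := exists_isClub n 0 (zero_add n) v
  obtain ⟨c, hc, hcM⟩ := hM.cost hn
  obtain ⟨c', hc', hcc'⟩ := c.exists_inverse
  have hU := c.toMatrix_mem_unitaryGroup
  set z := M v 0 with hz
  have hMv : c.toMatrix *ᵥ v = z • zeroKet n d := by
    rw [hcM, zeroKet_eq_single]
    funext x
    by_cases hx : x = 0
    · subst hx; simp [hz]
    · rw [Pi.smul_apply, Pi.single_eq_of_ne hx, smul_zero]
      by_contra h0
      exact hx (funext fun i => hM0 x (fun i hi => absurd hi (Nat.not_lt_zero _)) h0 i)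
  have hz1 : star z * z = 1 := by
    rw [← hv, ← star_mulVec_dotProduct_mulVec hU, hMv, zeroKet_eq_single]
    simp [mul_comm]
  obtain ⟨c'', hc'', hz'⟩ := cost_smul (d := d) hn hz1
  refine ⟨c' ++ c'', ?_, ?_⟩
  · have h1 := clubCost_le hd n
    have h2 : n < d ^ n := Nat.lt_pow_self (by omega)
    rw [List.length_append]
    nlinarith
  · rw [Circuit.toMatrix_append, ← Matrix.mulVec_mulVec, hz']
    dsimp only
    rw [← hMv, hcc', Matrix.mulVec_mulVec,
      ← Matrix.star_eq_conjTranspose, Matrix.mem_unitaryGroup_iff'.mp hU, Matrix.one_mulVec]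

end Synthesis

/-! ### The phase of the start state, and synthesis of unitaries -/

section Phase

variable {n d : ℕ}

/-- The diagonal operator with entries `h`. -/
def mulOp (h : Idx n d → ℂ) (ψ : Idx n d → ℂ) : Idx n d → ℂ :=
  fun x => h x * ψ x

theorem cost_mulOp_prod {G : SimpleGraph (Fin n)} {ι : Type*} [DecidableEq ι] (s : Finset ι)
    (h : ι → Idx n d → ℂ) (m : ℕ) (hm : ∀ j ∈ s, Cost G (mulOp (h j)) m) :
    Cost G (mulOp fun x => ∏ j ∈ s, h j x) (s.card * m) := by
  induction s using Finset.induction_on with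
  | empty => exact (Cost.id.mono (Nat.zero_le _)).congr fun ψ x => by simp [mulOp]
  | insert a s ha ih =>
    refine (((hm a (Finset.mem_insert_self a s)).comp
      (ih fun j hj => hm j (Finset.mem_insert_of_mem hj))).mono ?_).congr fun ψ x => ?_
    · rw [Finset.card_insert_of_notMem ha]
      linarith
    · simp only [mulOp, Finset.prod_insert ha, mul_assoc]

variable [NeZero d]

/-- The phase `e^{iθ}` on the level `0` and `e^{-iθ}` on the level `j`. -/
noncomputable def levelPhase (j : Fin d) (θ : ℝ) (q : Fin d) : ℂ :=
  if q = 0 then Complex.exp (θ * Complex.I) else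
    if q = j then Complex.exp (-θ * Complex.I) else 1

/-- The phases `levelPhase j θ` of the digit of `t`, if the digits of the positions from `a` up to
`t` vanish. -/
noncomputable def ctrlPhase (a : ℕ) (t : Fin n) (j : Fin d) (θ : ℝ) (x : Idx n d) : ℂ :=
  if ∀ i : Fin n, a ≤ i.val → i.val < t.val → x i = 0 then levelPhase j θ (x t) else 1

theorem star_exp_mul_I_mul (θ : ℝ) :
    star (Complex.exp (θ * Complex.I)) * Complex.exp (θ * Complex.I) = 1 := by
  rw [Complex.star_def, ← Complex.exp_conj, ← Complex.exp_add]
  simp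

theorem star_levelPhase_mul (j : Fin d) (θ : ℝ) (q : Fin d) :
    star (levelPhase j θ q) * levelPhase j θ q = 1 := by
  rw [levelPhase]
  split_ifs
  · exact star_exp_mul_I_mul θ
  · exact_mod_cast star_exp_mul_I_mul (-θ)
  · simp

omit [NeZero d] in
theorem diagonal_mem_unitaryGroup {h : Fin d → ℂ} (hh : ∀ q, star (h q) * h q = 1) :
    Matrix.diagonal h ∈ Matrix.unitaryGroup (Fin d) ℂ := by
  rw [Matrix.mem_unitaryGroup_iff', Matrix.star_eq_conjTranspose, Matrix.diagonal_conjTranspose,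
    Matrix.diagonal_mul_diagonal, ← Matrix.diagonal_one]
  exact congrArg _ (funext hh)

omit [NeZero d] in
theorem siteOp_diagonal (t : Fin n) (h : Fin d → ℂ) (ψ : Idx n d → ℂ) :
    siteOp t (Matrix.diagonal h) ψ = mulOp (fun x => h (x t)) ψ := by
  funext x
  rw [siteOp, mulOp, Finset.sum_eq_single (x t)]
  · simp
  · intro b _ hb
    simp [Matrix.diagonal_apply_ne _ hb.symm]
  · simp

omit [NeZero d] in
theorem siteOp_permMatrix (t : Fin n) (σ : Equiv.Perm (Fin d)) (ψ : Idx n d → ℂ) (x : Idx n d) :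
    siteOp t (σ.permMatrix ℂ) ψ x = ψ (Function.update x t (σ (x t))) := by
  rw [siteOp, Finset.sum_eq_single (σ (x t))]
  · simp [Equiv.Perm.permMatrix, PEquiv.toMatrix_apply]
  · intro b _ hb
    simp [Equiv.Perm.permMatrix, PEquiv.toMatrix_apply, hb.symm]
  · simp

theorem levelPhase_mul_swap {j : Fin d} (hj : j ≠ 0) (θ : ℝ) (q : Fin d) :
    levelPhase j (θ / 2) q * levelPhase j (-(θ / 2)) (Equiv.swap 0 j q) = levelPhase j θ q := by
  rw [levelPhase, levelPhase, levelPhase]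
  by_cases h0 : q = 0
  · rw [if_pos h0, if_pos h0, h0, Equiv.swap_apply_left, if_neg hj, if_pos rfl, ← Complex.exp_add]
    congr 1
    push_cast
    ring
  · rw [if_neg h0, if_neg h0]
    by_cases hqj : q = j
    · rw [if_pos hqj, if_pos hqj, hqj, Equiv.swap_apply_right, if_pos rfl, ← Complex.exp_add]
      congr 1
      push_cast
      ring
    · rw [if_neg hqj, if_neg hqj, Equiv.swap_apply_of_ne_of_ne h0 hqj, if_neg h0, if_neg hqj,
        one_mul]

theorem levelPhase_mul_neg (j : Fin d) (θ : ℝ) (q : Fin d) :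
    levelPhase j θ q * levelPhase j (-θ) q = 1 := by
  rw [levelPhase, levelPhase]
  split_ifs <;> simp [← Complex.exp_add]

theorem ctrlPhase_mul_neg (a : ℕ) (t : Fin n) (j : Fin d) (θ : ℝ) (x : Idx n d) :
    ctrlPhase a t j θ x * ctrlPhase a t j (-θ) x = 1 := by
  rw [ctrlPhase, ctrlPhase]
  split_ifs
  · exact levelPhase_mul_neg j θ _
  · exact one_mul 1

/-- Exchanging the levels `0` and `j` inverts the phase. Conjugating the phase of angle `-θ/2` by
the controlled exchange thus doubles the phase of angle `θ/2` if the control digit is `0`, and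
cancels it otherwise. -/
theorem ctrlPhase_step {a t : Fin n} (hat : a < t) {j : Fin d} (hj : j ≠ 0) (θ : ℝ)
    (ψ : Idx n d → ℂ) :
    mulOp (ctrlPhase a.val t j θ) ψ =
      mulOp (ctrlPhase (a.val + 1) t j (θ / 2))
        (ctrlOp a 0 t ((Equiv.swap 0 j).permMatrix ℂ)
          (mulOp (ctrlPhase (a.val + 1) t j (-(θ / 2)))
            (ctrlOp a 0 t ((Equiv.swap 0 j).permMatrix ℂ) ψ))) := by
  funext x
  have hat' : a.val < t.val := hat
  rw [mulOp, mulOp]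
  by_cases hx : x a = 0
  · have hcond : (∀ i : Fin n, a.val ≤ i.val → i.val < t.val → x i = 0) ↔
        ∀ i : Fin n, a.val + 1 ≤ i.val → i.val < t.val → x i = 0 := by
      refine ⟨fun h i hi => h i (by omega), fun h i hi hit => ?_⟩
      rcases Nat.eq_or_lt_of_le hi with e | hlt
      · rw [← Fin.ext e]; exact hx
      · exact h i hlt hit
    have hcond' : (∀ i : Fin n, a.val + 1 ≤ i.val → i.val < t.val →
          Function.update x t (Equiv.swap 0 j (x t)) i = 0) ↔
        ∀ i : Fin n, a.val + 1 ≤ i.val → i.val < t.val → x i = 0 := by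
      refine forall_congr' fun i => imp_congr_right fun _ => imp_congr_right fun hi => ?_
      rw [Function.update_of_ne (fun e => by simp [e] at hi)]
    have hxa : Function.update x t (Equiv.swap 0 j (x t)) a = 0 := by
      rw [Function.update_of_ne hat.ne, hx]
    rw [ctrlOp_apply_of_eq hx, siteOp_permMatrix, mulOp, ctrlOp_apply_of_eq hxa,
      siteOp_permMatrix, ← mul_assoc]
    have hψ : Function.update (Function.update x t (Equiv.swap 0 j (x t))) t
        (Equiv.swap 0 j (Function.update x t (Equiv.swap 0 j (x t)) t)) = x := by
      simp
    rw [hψ]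
    congr 1
    rw [ctrlPhase, ctrlPhase, ctrlPhase]
    simp only [hcond, hcond', Function.update_self]
    split_ifs
    · exact (levelPhase_mul_swap hj θ _).symm
    · rw [one_mul]
  · rw [ctrlOp_apply_of_ne hx, mulOp, ctrlOp_apply_of_ne hx, ← mul_assoc, ctrlPhase_mul_neg,
      ctrlPhase, if_neg fun h => hx (h a le_rfl hat')]

/-- The number of gates for a phase with `k` controls. -/
def phaseCost : ℕ → ℕ
  | 0 => 1
  | k + 1 => 2 * phaseCost k + 4 * (k + 1)

theorem phaseCost_le (k : ℕ) : phaseCost k + (4 * k + 8) ≤ 9 * 2 ^ k := by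
  induction k with
  | zero => simp [phaseCost]
  | succ k ih => rw [phaseCost, pow_succ]; omega

theorem cost_ctrlPhase (hn : 2 ≤ n) {j : Fin d} (hj : j ≠ 0) (t : Fin n) (k : ℕ) :
    ∀ (a : ℕ) (θ : ℝ), a + k = t.val →
      Cost (SimpleGraph.pathGraph n) (mulOp (ctrlPhase a t j θ)) (phaseCost k) := by
  induction k with
  | zero =>
    intro a θ ha
    refine (cost_siteOp hn t (diagonal_mem_unitaryGroup (star_levelPhase_mul j θ))).congr
      fun ψ x => ?_
    rw [siteOp_diagonal, mulOp, mulOp, ctrlPhase, if_pos fun i h1 h2 => by omega]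
  | succ k ih =>
    intro a θ ha
    let s : Fin n := ⟨a, by omega⟩
    have hst : s < t := by rw [Fin.lt_def]; simp only [s]; omega
    have hc := cost_ctrlOp hst 0 (permMatrix_mem_unitaryGroup (Equiv.swap 0 j))
    refine (((ih (a + 1) (θ / 2) (by omega)).comp (hc.comp
      ((ih (a + 1) (-(θ / 2)) (by omega)).comp hc))).mono ?_).congr fun ψ x => ?_
    · have : t.val - s.val = k + 1 := by simp only [s]; omega
      rw [this, phaseCost]
      omega
    · exact congrFun (ctrlPhase_step hst hj θ ψ) x

/-- The phase `e^{iθ}` on the labels whose first `m` digits vanish. -/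
noncomputable def zeroPhase (m : ℕ) (θ : ℝ) (x : Idx n d) : ℂ :=
  if ∀ i : Fin n, i.val < m → x i = 0 then Complex.exp (θ * Complex.I) else 1

/-- When the earlier digits vanish, the level `0` of `t` collects `θ/d` a total of `d` times; on a
level `j ≠ 0`, the factor of `j` cancels the common phase. -/
theorem zeroPhase_succ (t : Fin n) (θ : ℝ) (x : Idx n d) :
    zeroPhase (t.val + 1) θ x = zeroPhase t.val (θ / d) x *
      ∏ j ∈ Finset.univ.erase (0 : Fin d), ctrlPhase 0 t j (θ / d) x := by
  have hd : (d : ℂ) ≠ 0 := Nat.cast_ne_zero.mpr (NeZero.ne d)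
  have hcond : (∀ i : Fin n, i.val < t.val + 1 → x i = 0) ↔
      (∀ i : Fin n, i.val < t.val → x i = 0) ∧ x t = 0 := by
    refine ⟨fun h => ⟨fun i hi => h i (by omega), h t (Nat.lt_succ_self _)⟩, fun h i hi => ?_⟩
    rcases Nat.lt_succ_iff_lt_or_eq.mp hi with hi | hi
    · exact h.1 i hi
    · rw [Fin.ext hi]; exact h.2
  simp only [zeroPhase, ctrlPhase, hcond, Nat.zero_le, true_imp_iff]
  by_cases h : ∀ i : Fin n, i.val < t.val → x i = 0
  · simp only [if_pos h, levelPhase]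
    by_cases hx : x t = 0
    · rw [if_pos ⟨h, hx⟩]
      simp only [if_pos hx, Finset.prod_const, Finset.card_erase_of_mem (Finset.mem_univ _),
        Finset.card_univ, Fintype.card_fin]
      rw [← pow_succ', Nat.sub_add_cancel (Nat.one_le_iff_ne_zero.mpr (NeZero.ne d)),
        ← Complex.exp_nat_mul]
      congr 1
      push_cast
      field_simp
    · rw [if_neg fun h => hx h.2]
      simp only [if_neg hx]
      rw [Finset.prod_ite_eq, if_pos (Finset.mem_erase.mpr ⟨hx, Finset.mem_univ _⟩),
        ← Complex.exp_add]
      simp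
  · rw [if_neg h, if_neg fun h' => h h'.1]
    simp only [if_neg h, Finset.prod_const_one, mul_one]

theorem cost_zeroPhase (hn : 2 ≤ n) (hd : 2 ≤ d) (m : ℕ) : ∀ θ : ℝ, m ≤ n →
    Cost (SimpleGraph.pathGraph n) (mulOp (zeroPhase (n := n) (d := d) m θ)) (9 * d * d ^ m) := by
  induction m with
  | zero =>
    intro θ _
    refine ((cost_smul hn (star_exp_mul_I_mul θ)).mono (by nlinarith)).congr fun ψ x => ?_
    simp [mulOp, zeroPhase]
  | succ m ih =>
    intro θ hm
    let t : Fin n := ⟨m, hm⟩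
    have h := (ih (θ / d) (Nat.le_of_succ_le hm)).comp
      (cost_mulOp_prod (Finset.univ.erase (0 : Fin d)) (fun j => ctrlPhase 0 t j (θ / d)) _
        fun j hj => cost_ctrlPhase hn (Finset.ne_of_mem_erase hj) t m 0 (θ / d) (zero_add m))
    refine (h.mono ?_).congr fun ψ x => ?_
    · rw [Finset.card_erase_of_mem (Finset.mem_univ _), Finset.card_univ, Fintype.card_fin,
        pow_succ d]
      have h1 : phaseCost m ≤ 9 * d ^ m :=
        (le_trans (Nat.le_add_right _ _) (phaseCost_le m)).trans
          (Nat.mul_le_mul_left 9 (Nat.pow_le_pow_left hd m))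
      have h2 : (d - 1) * phaseCost m ≤ d * (9 * d ^ m) := Nat.mul_le_mul (Nat.sub_le _ _) h1
      nlinarith [Nat.mul_le_mul_right (9 * d * d ^ m) hd]
    · have := zeroPhase_succ t θ x
      simp only [t] at this
      simp only [mulOp, this, mul_assoc]
      rfl

theorem exists_circuit_reflectionMatrix_single (hn : 2 ≤ n) (hd : 2 ≤ d) {z : ℂ}
    (hz : star z * z = 1) :
    ∃ c : Circuit (SimpleGraph.pathGraph n) d, c.length ≤ 9 * d * d ^ n ∧
      c.toMatrix = reflectionMatrix (zeroKet n d) z := by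
  have hz' : ‖z‖ = 1 := by
    have : (‖z‖ : ℂ) ^ 2 = 1 := by rw [← Complex.conj_mul']; exact hz
    have h2 : ‖z‖ ^ 2 = 1 := by exact_mod_cast this
    exact (pow_eq_one_iff_of_nonneg (norm_nonneg z) two_ne_zero).mp h2
  have hzθ : Complex.exp (Complex.arg z * Complex.I) = z := by
    have := Complex.norm_mul_exp_arg_mul_I z
    rwa [hz', Complex.ofReal_one, one_mul] at this
  obtain ⟨c, hc, hcF⟩ := cost_zeroPhase hn hd n (Complex.arg z) le_rfl
  refine ⟨c, hc, matrix_ext_mulVec fun ψ => ?_⟩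
  rw [hcF, reflectionMatrix_mulVec, zeroKet_eq_single]
  funext x
  rw [mulOp, zeroPhase, hzθ]
  by_cases hx : x = 0
  · subst hx
    simp
    ring
  · have : ¬ ∀ i : Fin n, i.val < n → x i = 0 := fun h => hx (funext fun i => h i i.isLt)
    rw [if_neg this]
    simp [hx]

theorem mul_reflectionMatrix_mul {ι : Type*} [Fintype ι] [DecidableEq ι] {U : Matrix ι ι ℂ}
    (hU : U ∈ Matrix.unitaryGroup ι ℂ) (v : ι → ℂ) (z : ℂ) :
    U * reflectionMatrix v z * Uᴴ = reflectionMatrix (U *ᵥ v) z := by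
  refine matrix_ext_mulVec fun y => ?_
  have h : star (U *ᵥ v) ⬝ᵥ y = star v ⬝ᵥ (Uᴴ *ᵥ y) := by
    rw [Matrix.star_mulVec, Matrix.dotProduct_mulVec]
  rw [← Matrix.mulVec_mulVec, ← Matrix.mulVec_mulVec, reflectionMatrix_mulVec,
    reflectionMatrix_mulVec, h, Matrix.mulVec_add, Matrix.mulVec_smul, Matrix.mulVec_mulVec,
    ← Matrix.star_eq_conjTranspose, Matrix.mem_unitaryGroup_iff.mp hU, Matrix.one_mulVec]

theorem exists_circuit_isReflection (hn : 2 ≤ n) (hd : 2 ≤ d)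
    {H : Matrix (Idx n d) (Idx n d) ℂ} (hH : IsReflection H) :
    ∃ c : Circuit (SimpleGraph.pathGraph n) d, c.length ≤ (50 + 9 * d) * d ^ n ∧
      c.toMatrix = H := by
  obtain rfl | ⟨v, z, hv, hz, rfl⟩ := hH
  · exact ⟨[], Nat.zero_le _, rfl⟩
  obtain ⟨c, hc, hcv⟩ := exists_circuit_mulVec_zeroKet hn hd v hv
  obtain ⟨c', hc', hcc'⟩ := c.exists_inverse
  obtain ⟨r, hr, hrz⟩ := exists_circuit_reflectionMatrix_single (n := n) hn hd hz
  -- Preparing the axis and its inverse cost `25 * d ^ n` each, the phase in between `9 * d * d ^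
  -- n`.
  refine ⟨c ++ r ++ c', ?_, ?_⟩
  · rw [List.length_append, List.length_append, hc']
    linarith
  · rw [Circuit.toMatrix_append, Circuit.toMatrix_append, hcc', hrz,
      mul_reflectionMatrix_mul c.toMatrix_mem_unitaryGroup, hcv]

/-- Synthesis of unitaries on the chain. -/
theorem exists_circuit_unitary (hn : 2 ≤ n) (hd : 2 ≤ d)
    {U : Matrix (Idx n d) (Idx n d) ℂ} (hU : U ∈ Matrix.unitaryGroup (Idx n d) ℂ) :
    ∃ c : Circuit (SimpleGraph.pathGraph n) d, c.length ≤ (50 + 9 * d) * d ^ (2 * n) ∧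
      c.toMatrix = U := by
  obtain ⟨L, hL, hLr, rfl⟩ := exists_list_isReflection hU
  have key : ∀ L : List (Matrix (Idx n d) (Idx n d) ℂ), (∀ H ∈ L, IsReflection H) →
      ∃ c : Circuit (SimpleGraph.pathGraph n) d,
        c.length ≤ L.length * ((50 + 9 * d) * d ^ n) ∧ c.toMatrix = L.prod := by
    intro L
    induction L with
    | nil => exact fun _ => ⟨[], by simp, rfl⟩
    | cons H L ih =>
      intro h
      obtain ⟨c, hc, hcL⟩ := ih fun K hK => h K (List.mem_cons_of_mem H hK)
      obtain ⟨r, hr, hrH⟩ := exists_circuit_isReflection hn hd (h H List.mem_cons_self)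
      refine ⟨r ++ c, ?_, by rw [Circuit.toMatrix_append, hrH, hcL, List.prod_cons]⟩
      rw [List.length_append, List.length_cons]
      linarith
  obtain ⟨c, hc, hcL⟩ := key L hLr
  refine ⟨c, hc.trans ?_, hcL⟩
  rw [Fintype.card_fun, Fintype.card_fin, Fintype.card_fin] at hL
  calc L.length * ((50 + 9 * d) * d ^ n) ≤ d ^ n * ((50 + 9 * d) * d ^ n) :=
        Nat.mul_le_mul_right _ hL
    _ = (50 + 9 * d) * d ^ (2 * n) := by rw [two_mul, pow_add]; ring

end Phase

/-! ### Architectures that contain the chain -/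

section Transport

variable {n d : ℕ}

/-- The relabelling of the computational basis by a permutation of the qudits. -/
def relabel (σ : Equiv.Perm (Fin n)) : Idx n d ≃ Idx n d :=
  Equiv.arrowCongr σ.symm (Equiv.refl (Fin d))

theorem relabel_apply (σ : Equiv.Perm (Fin n)) (x : Idx n d) : relabel σ x = x ∘ σ := rfl

theorem twoQuditOp_relabel (σ : Equiv.Perm (Fin n)) (i j : Fin n)
    (g : Matrix (Fin d × Fin d) (Fin d × Fin d) ℂ) :
    twoQuditOp (σ i) (σ j) g = (twoQuditOp i j g).submatrix (relabel σ) (relabel σ) := by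
  ext x y
  simp only [twoQuditOp, Matrix.of_apply, Matrix.submatrix_apply, relabel_apply,
    Function.comp_apply]
  refine if_congr ⟨fun h v hi hj => h (σ v) (by simpa using hi) (by simpa using hj),
    fun h v hi hj => ?_⟩ rfl rfl
  have := h (σ.symm v) (fun e => hi (by simp [← e])) (fun e => hj (by simp [← e]))
  simpa using this

theorem Circuit.exists_relabel {G H : SimpleGraph (Fin n)} (σ : Equiv.Perm (Fin n))
    (hσ : ∀ i j, H.Adj i j → G.Adj (σ i) (σ j)) (c : Circuit H d) :
    ∃ c' : Circuit G d, c'.length = c.length ∧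
      c'.toMatrix = c.toMatrix.submatrix (relabel σ) (relabel σ) := by
  induction c with
  | nil => exact ⟨[], rfl, by simp [Circuit.toMatrix_nil]⟩
  | cons g c ih =>
    obtain ⟨c', h, h'⟩ := ih
    refine ⟨⟨σ g.fst, σ g.snd, hσ _ _ g.adj, g.op⟩ :: c', by simp [h], ?_⟩
    rw [Circuit.toMatrix_cons, Circuit.toMatrix_cons, h', Gate.toMatrix, Gate.toMatrix,
      twoQuditOp_relabel, Matrix.submatrix_mul_equiv]

theorem exists_perm_of_isContained {H G : SimpleGraph (Fin n)} (h : H.IsContained G) :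
    ∃ σ : Equiv.Perm (Fin n), ∀ i j, H.Adj i j → G.Adj (σ i) (σ j) := by
  obtain ⟨f⟩ := h
  exact ⟨Equiv.ofBijective f (Finite.injective_iff_bijective.mp f.injective'),
    fun i j hij => f.toHom.map_adj hij⟩

theorem submatrix_mem_unitaryGroup {ι : Type*} [Fintype ι] [DecidableEq ι] {U : Matrix ι ι ℂ}
    (hU : U ∈ Matrix.unitaryGroup ι ℂ) (e : Equiv.Perm ι) :
    U.submatrix e e ∈ Matrix.unitaryGroup ι ℂ := by
  rw [Matrix.mem_unitaryGroup_iff, Matrix.star_eq_conjTranspose, Matrix.conjTranspose_submatrix,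
    Matrix.submatrix_mul_equiv, ← Matrix.star_eq_conjTranspose, Matrix.mem_unitaryGroup_iff.mp hU,
    Matrix.submatrix_one_equiv]

theorem unitaryComplexity_le (hn : 2 ≤ n) (hd : 2 ≤ d) {G : SimpleGraph (Fin n)}
    (hG : (SimpleGraph.pathGraph n).IsContained G) (U : Matrix.unitaryGroup (Idx n d) ℂ) :
    unitaryComplexity G U ≤ (((50 + 9 * d) * d ^ (2 * n) : ℕ) : ℕ∞) := by
  have : NeZero d := ⟨by omega⟩
  obtain ⟨σ, hσ⟩ := exists_perm_of_isContained hG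
  obtain ⟨c, hc, hcU⟩ := exists_circuit_unitary hn hd
    (submatrix_mem_unitaryGroup U.2 (relabel σ).symm)
  obtain ⟨c', hc', hcc'⟩ := c.exists_relabel σ hσ
  refine (iInf₂_le c' ?_).trans (by rw [hc']; exact_mod_cast hc)
  rw [hcc', hcU, Matrix.submatrix_submatrix]
  simp

theorem stateComplexity_le (hn : 2 ≤ n) (hd : 2 ≤ d) {G : SimpleGraph (Fin n)}
    (hG : (SimpleGraph.pathGraph n).IsContained G)
    (ψ : Metric.sphere (0 : StateSpace n d) 1) :
    stateComplexity G ψ ≤ ((25 * d ^ n : ℕ) : ℕ∞) := by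
  have : NeZero d := ⟨by omega⟩
  obtain ⟨σ, hσ⟩ := exists_perm_of_isContained hG
  have hv : star ((ψ : StateSpace n d).ofLp ∘ (relabel σ).symm) ⬝ᵥ
      ((ψ : StateSpace n d).ofLp ∘ (relabel σ).symm) = 1 := by
    have h1 : ‖(ψ : StateSpace n d)‖ = 1 := by simp
    have h2 : inner ℂ (ψ : StateSpace n d) (ψ : StateSpace n d) = 1 := by
      rw [inner_self_eq_norm_sq_to_K, h1]; simp
    rw [EuclideanSpace.inner_eq_star_dotProduct, dotProduct_comm] at h2
    rw [← h2, dotProduct, dotProduct]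
    exact Equiv.sum_comp (relabel σ).symm
      fun x => star (ψ : StateSpace n d).ofLp x * (ψ : StateSpace n d).ofLp x
  obtain ⟨c, hc, hcv⟩ := exists_circuit_mulVec_zeroKet hn hd _ hv
  obtain ⟨c', hc', hcc'⟩ := c.exists_relabel σ hσ
  refine (iInf₂_le c' ?_).trans (by rw [hc']; exact_mod_cast hc)
  have hz : zeroKet n d ∘ (relabel σ).symm = zeroKet n d := by
    funext x
    simp only [zeroKet, Function.comp_apply]
    refine if_congr ⟨fun h i => ?_, fun h i => h _⟩ rfl rfl
    simpa [relabel] using h (σ i)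
  rw [hcc', Matrix.submatrix_mulVec_equiv, hz, hcv]
  funext x
  simp

end Transport

/-! ### Lower bounds by dimension -/

section Dimension

/-- A `C¹` map does not raise Hausdorff dimension. -/
theorem measure_range_eq_zero_of_finrank_lt {E F : Type*} [NormedAddCommGroup E]
    [NormedSpace ℝ E] [FiniteDimensional ℝ E] [NormedAddCommGroup F] [NormedSpace ℝ F]
    [FiniteDimensional ℝ F] [MeasurableSpace F] [BorelSpace F] (μ : Measure F)
    [μ.IsAddHaarMeasure] {f : E → F} (hf : ContDiff ℝ 1 f)
    (h : Module.finrank ℝ E < Module.finrank ℝ F) : μ (Set.range f) = 0 := by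
  refine measure_zero_of_dimH_lt (d := Module.finrank ℝ F) ?_
    (hf.dimH_range_le.trans_lt (by exact_mod_cast h))
  rw [NNReal.coe_natCast]
  exact Measure.absolutelyContinuous_isAddHaarMeasure _ _

theorem measurableSet_range_of_continuous {X Y : Type*} [TopologicalSpace X]
    [SigmaCompactSpace X] [TopologicalSpace Y] [T2Space Y] [MeasurableSpace Y]
    [OpensMeasurableSpace Y] {f : X → Y} (hf : Continuous f) : MeasurableSet (Set.range f) := by
  obtain ⟨K, hK, hKf⟩ := isSigmaCompact_range hf
  rw [← hKf]
  exact MeasurableSet.iUnion fun i => (hK i).measurableSet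

variable {ι E : Type*} [Fintype ι] [DecidableEq ι] [NormedAddCommGroup E] [NormedSpace ℝ E]

/-- The entries of a matrix depend on the parameters in a `C¹` way. -/
def EntriesContDiff (A : E → Matrix ι ι ℂ) : Prop :=
  ∀ i j, ContDiff ℝ 1 fun p => A p i j

omit [DecidableEq ι] in
theorem EntriesContDiff.mul {A B : E → Matrix ι ι ℂ} (hA : EntriesContDiff A)
    (hB : EntriesContDiff B) : EntriesContDiff fun p => A p * B p := fun i j => by
  simp only [Matrix.mul_apply]
  exact ContDiff.sum fun k _ => (hA i k).mul (hB k j)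

omit [Fintype ι] [DecidableEq ι] in
theorem EntriesContDiff.const (A : Matrix ι ι ℂ) : EntriesContDiff fun _ : E => A :=
  fun _ _ => contDiff_const

theorem EntriesContDiff.list_prod (L : List (E → Matrix ι ι ℂ)) (hL : ∀ A ∈ L, EntriesContDiff A) :
    EntriesContDiff fun p => (L.map fun A => A p).prod := by
  induction L with
  | nil => exact .const 1
  | cons A L ih =>
    simp only [List.map_cons, List.prod_cons]
    exact (hL A List.mem_cons_self).mul (ih fun B hB => hL B (List.mem_cons_of_mem A hB))

/-- The Hermitian matrix with real parameters `B`. -/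
noncomputable def hermitianOf (B : ι → ι → ℝ) : Matrix ι ι ℂ :=
  Matrix.of fun i j => ((B i j + B j i : ℝ) : ℂ) + ((B i j - B j i : ℝ) : ℂ) * Complex.I

omit [Fintype ι] [DecidableEq ι] in
theorem exists_hermitianOf_eq {P : Matrix ι ι ℂ} (hP : P.IsHermitian) :
    ∃ B, hermitianOf B = P := by
  -- Real parts are symmetric and imaginary parts antisymmetric, so sum and difference with the
  -- transpose recover them.
  refine ⟨fun i j => ((P i j).re + (P i j).im) / 2, ?_⟩
  ext i j
  have h := hP.apply j i
  have h1 : (P j i).re = (P i j).re := by rw [← h]; simp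
  have h2 : (P j i).im = -(P i j).im := by rw [← h]; simp
  apply Complex.ext
  · simp [hermitianOf, h1, h2]
    ring
  · simp [hermitianOf, h1, h2]
    ring

open scoped ComplexOrder in
/-- The polar decomposition of an invertible matrix. -/
theorem exists_isHermitian_mul_unitary {A : Matrix ι ι ℂ} (hA : A.det ≠ 0) :
    ∃ P V : Matrix ι ι ℂ, P.IsHermitian ∧ V ∈ Matrix.unitaryGroup ι ℂ ∧ A = P * V := by
  have hS : (A * Aᴴ).PosSemidef := Matrix.posSemidef_self_mul_conjTranspose A
  set U : Matrix ι ι ℂ := hS.1.eigenvectorUnitary.1 with hU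
  have hUU : Uᴴ * U = 1 := Matrix.mem_unitaryGroup_iff'.mp hS.1.eigenvectorUnitary.2
  set D : Matrix ι ι ℂ := Matrix.diagonal fun i => ((Real.sqrt (hS.1.eigenvalues i) : ℝ) : ℂ)
    with hD
  have hDD : D * D = Matrix.diagonal (RCLike.ofReal ∘ hS.1.eigenvalues) := by
    rw [hD, Matrix.diagonal_mul_diagonal]
    congr 1
    funext i
    rw [← Complex.ofReal_mul, Real.mul_self_sqrt (hS.eigenvalues_nonneg i)]
    rfl
  have hDh : Dᴴ = D := by
    rw [hD, Matrix.diagonal_conjTranspose]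
    congr 1
    funext i
    simp
  set P := U * D * Uᴴ with hP
  have hPP : P * P = A * Aᴴ := by
    calc P * P = U * D * (Uᴴ * U) * D * Uᴴ := by simp only [hP, mul_assoc]
      _ = U * (D * D) * Uᴴ := by rw [hUU, mul_one, mul_assoc U D D]
      _ = A * Aᴴ := by
        conv_rhs => rw [hS.1.spectral_theorem, Unitary.conjStarAlgAut_apply]
        rw [hDD]
        rfl
  have hPh : Pᴴ = P := by
    rw [hP, Matrix.conjTranspose_mul, Matrix.conjTranspose_mul, hDh,
      Matrix.conjTranspose_conjTranspose, mul_assoc]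
  have hPdet : IsUnit P.det := by
    rw [isUnit_iff_ne_zero]
    intro h0
    have := congrArg Matrix.det hPP
    rw [Matrix.det_mul P P, Matrix.det_mul A, h0, zero_mul, Matrix.det_conjTranspose] at this
    exact mul_ne_zero hA (star_ne_zero.mpr hA) this.symm
  refine ⟨P, P⁻¹ * A, hPh, ?_, (Matrix.mul_nonsing_inv_cancel_left P A hPdet).symm⟩
  rw [Matrix.mem_unitaryGroup_iff, Matrix.star_eq_conjTranspose, Matrix.conjTranspose_mul,
    Matrix.conjTranspose_nonsing_inv, hPh, mul_assoc, ← mul_assoc A, ← hPP, mul_assoc P,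
    Matrix.mul_nonsing_inv P hPdet, mul_one, Matrix.nonsing_inv_mul P hPdet]

end Dimension

/-! ### Short circuits reach only null sets -/

section LowerBounds

variable {n d : ℕ}

/-- The parameters of `m` gates: the entries of their matrices. -/
abbrev GateParams (d m : ℕ) : Type := Fin m → Fin d × Fin d → Fin d × Fin d → ℂ

/-- The product of two-qudit operators on given pairs of qudits with given matrices. -/
def opProduct {m : ℕ} (e : Fin m → Fin n × Fin n) (M : GateParams d m) :
    Matrix (Idx n d) (Idx n d) ℂ :=
  (List.ofFn fun k => twoQuditOp (e k).1 (e k).2 (Matrix.of (M k))).prod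

theorem entriesContDiff_opProduct {m : ℕ} (e : Fin m → Fin n × Fin n) :
    EntriesContDiff fun M : GateParams d m => opProduct e M := by
  have h := EntriesContDiff.list_prod (List.ofFn fun (k : Fin m) (M : GateParams d m) =>
    twoQuditOp (e k).1 (e k).2 (Matrix.of (M k))) ?_
  · simpa [opProduct, List.map_ofFn, Function.comp_def] using h
  · intro A hA
    obtain ⟨k, rfl⟩ := (List.mem_ofFn' _ _).mp hA
    intro x y
    simp only [twoQuditOp, Matrix.of_apply]
    split_ifs
    · fun_prop
    · exact contDiff_const

theorem Circuit.exists_opProduct_eq {G : SimpleGraph (Fin n)} (c : Circuit G d) :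
    ∃ (e : Fin c.length → Fin n × Fin n) (M : GateParams d c.length),
      opProduct e M = c.toMatrix := by
  refine ⟨fun k => ((c.get k).fst, (c.get k).snd), fun k => (c.get k).op.1, ?_⟩
  unfold opProduct Circuit.toMatrix
  conv_rhs => rw [← List.ofFn_get c, List.map_ofFn]
  rfl

theorem finrank_gateParams (d m : ℕ) :
    Module.finrank ℝ (GateParams d m) = 2 * m * d ^ 4 := by
  simp [GateParams, Module.finrank_pi_fintype]
  ring

theorem ae_opProduct_ne_state {m : ℕ} (hm : 2 * m * d ^ 4 + 1 < 2 * d ^ n)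
    (e : Fin m → Fin n × Fin n) :
    ∀ᵐ (ψ : Metric.sphere (0 : StateSpace n d) 1) ∂(sphereMeasure n d), ∀ M : GateParams d m,
      opProduct e M *ᵥ zeroKet n d ≠ (ψ : StateSpace n d).ofLp := by
  let f : ℝ × GateParams d m → StateSpace n d := fun p =>
    WithLp.toLp 2 (p.1 • (opProduct e p.2 *ᵥ zeroKet n d))
  have hf : ContDiff ℝ 1 f := by
    rw [contDiff_piLp]
    intro x
    simp only [f, Pi.smul_apply, Matrix.mulVec, dotProduct]
    refine contDiff_fst.smul (ContDiff.sum fun y _ => ?_)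
    exact ((entriesContDiff_opProduct e x y).comp contDiff_snd).mul contDiff_const
  have hnull : (volume : Measure (StateSpace n d)) (Set.range f) = 0 := by
    refine measure_range_eq_zero_of_finrank_lt _ hf ?_
    rw [Module.finrank_prod, finrank_gateParams]
    have : Module.finrank ℝ (StateSpace n d) = 2 * d ^ n := by
      rw [← Module.finrank_mul_finrank ℝ ℂ (StateSpace n d)]
      simp
    rw [this, Module.finrank_self]
    omega
  have hS : MeasurableSet {ψ : Metric.sphere (0 : StateSpace n d) 1 |
      (ψ : StateSpace n d) ∈ Set.range f} :=
    measurable_subtype_coe (measurableSet_range_of_continuous hf.continuous)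
  have h0 : sphereMeasure n d {ψ : Metric.sphere (0 : StateSpace n d) 1 |
      (ψ : StateSpace n d) ∈ Set.range f} = 0 := by
    rw [sphereMeasure, Measure.toSphere_apply' _ hS]
    refine mul_eq_zero_of_right _ (measure_mono_null ?_ hnull)
    -- The cone that defines the sphere measure lies in the range of `f`, as the first parameter
    -- absorbs the radius.
    rintro _ ⟨r, -, _, ⟨ψ, ⟨p, hp⟩, rfl⟩, rfl⟩
    refine ⟨(r * p.1, p.2), ?_⟩
    dsimp only
    rw [← hp]
    ext x
    simp [f, mul_assoc]
  filter_upwards [measure_eq_zero_iff_ae_notMem.mp h0] with ψ hψ M hM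
  refine hψ ⟨(1, M), ?_⟩
  ext x
  simp [f, hM]

/-- Hermitian matrices have real dimension `d ^ (2 * n)`, half that of all matrices, so Hermitian
times short circuit is still null. -/
theorem ae_opProduct_ne_unitary {m : ℕ} (hm : 2 * m * d ^ 4 < d ^ (2 * n))
    (e : Fin m → Fin n × Fin n) :
    ∀ᵐ (U : Matrix.unitaryGroup (Idx n d) ℂ) ∂(haarUnitary n d), ∀ M : GateParams d m,
      opProduct e M ≠ (U : Matrix (Idx n d) (Idx n d) ℂ) := by
  let f : Matrix (Idx n d) (Idx n d) ℂ → (Idx n d → Idx n d → ℝ) × GateParams d m →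
      (Idx n d → Idx n d → ℂ) := fun Q p => hermitianOf p.1 * opProduct e p.2 * Q
  have hf : ∀ Q, ContDiff ℝ 1 (f Q) := by
    intro Q
    refine contDiff_pi.mpr fun x => contDiff_pi.mpr fun y => ?_
    refine (EntriesContDiff.mul (EntriesContDiff.mul ?_ ?_) (.const Q)) x y
    · intro x y
      have h1 : ContDiff ℝ 1 fun p : (Idx n d → Idx n d → ℝ) × GateParams d m =>
          p.1 x y + p.1 y x := by fun_prop
      have h2 : ContDiff ℝ 1 fun p : (Idx n d → Idx n d → ℝ) × GateParams d m =>
          p.1 x y - p.1 y x := by fun_prop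
      exact (Complex.ofRealCLM.contDiff.comp h1).add
        ((Complex.ofRealCLM.contDiff.comp h2).mul contDiff_const)
    · exact fun x y => (entriesContDiff_opProduct e x y).comp contDiff_snd
  have hnull : ∀ Q, (Measure.addHaar : Measure (Idx n d → Idx n d → ℂ)) (Set.range (f Q)) = 0 := by
    intro Q
    refine measure_range_eq_zero_of_finrank_lt _ (hf Q) ?_
    rw [Module.finrank_prod, finrank_gateParams]
    simp only [Module.finrank_pi_fintype, Finset.sum_const, Finset.card_univ, smul_eq_mul,
      Complex.finrank_real_complex, Module.finrank_self, Fintype.card_fun, Fintype.card_fin]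
    rw [two_mul n, pow_add] at hm
    linarith
  have hT : MeasurableSet (Set.range (f 1)) :=
    measurableSet_range_of_continuous (hf 1).continuous
  have hprod : Measurable (β := Idx n d → Idx n d → ℂ)
      fun q : (Idx n d → Idx n d → ℂ) × Matrix.unitaryGroup (Idx n d) ℂ =>
        Matrix.of q.1 * (q.2 : Matrix (Idx n d) (Idx n d) ℂ) := by
    refine measurable_pi_iff.mpr fun x => measurable_pi_iff.mpr fun y => ?_
    simp only [Matrix.mul_apply, Matrix.of_apply]
    refine Finset.measurable_sum _ fun z _ => Measurable.mul ?_ ?_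
    · exact (measurable_pi_apply z).comp ((measurable_pi_apply x).comp measurable_fst)
    · have : Continuous fun U : Matrix.unitaryGroup (Idx n d) ℂ =>
          (U : Matrix (Idx n d) (Idx n d) ℂ) z y :=
        continuous_subtype_val.matrix_elem z y
      exact this.measurable.comp measurable_snd
  have : IsFiniteMeasure (haarUnitary n d) := by unfold haarUnitary; infer_instance
  have : (haarUnitary n d).IsMulLeftInvariant := by unfold haarUnitary; infer_instance
  have key : ∀ᵐ A ∂(Measure.addHaar : Measure (Idx n d → Idx n d → ℂ)), ∀ᵐ (U : Matrix.unitaryGroup (Idx n d) ℂ) ∂(haarUnitary n d),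
      Matrix.of A * (U : Matrix (Idx n d) (Idx n d) ℂ) ∉ Set.range (f 1) := by
    -- After exchanging the quantifiers, `A * U ∈ range (f 1)` for fixed `U` means that `A` lies in
    -- the null set `range (f (star U))`.
    rw [Measure.ae_ae_comm (hprod hT).compl]
    refine Filter.Eventually.of_forall fun U => ?_
    filter_upwards [measure_eq_zero_iff_ae_notMem.mp
      (hnull (star (U : Matrix (Idx n d) (Idx n d) ℂ)))] with A hA
    rintro ⟨p, hp⟩
    refine hA ⟨p, ?_⟩
    have hp' : hermitianOf p.1 * opProduct e p.2 * 1 =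
      Matrix.of A * (U : Matrix (Idx n d) (Idx n d) ℂ) := hp
    change hermitianOf p.1 * opProduct e p.2 * star (U : Matrix (Idx n d) (Idx n d) ℂ) =
      Matrix.of A
    rw [← mul_one (hermitianOf p.1 * _), hp', mul_assoc, Matrix.mem_unitaryGroup_iff.mp U.2,
      mul_one]
  obtain ⟨A, hA, hAdet⟩ : ∃ A : Idx n d → Idx n d → ℂ, (∀ᵐ (U : Matrix.unitaryGroup (Idx n d) ℂ) ∂(haarUnitary n d),
      Matrix.of A * (U : Matrix (Idx n d) (Idx n d) ℂ) ∉ Set.range (f 1)) ∧ (Matrix.of A).det ≠ 0 := by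
    by_contra! hcon
    have hopen : IsOpen {A : Idx n d → Idx n d → ℂ | (Matrix.of A).det ≠ 0} :=
      isOpen_ne_fun (Continuous.matrix_det continuous_id) continuous_const
    refine (hopen.measure_pos Measure.addHaar ⟨(1 : Matrix _ _ ℂ), ?_⟩).ne' ?_
    · exact (Matrix.det_one (R := ℂ) (n := Idx n d)).trans_ne one_ne_zero
    · rw [measure_eq_zero_iff_ae_notMem]
      filter_upwards [key] with A hA
      simpa using hcon A hA
  obtain ⟨P, V, hP, hV, hAPV⟩ := exists_isHermitian_mul_unitary hAdet
  obtain ⟨B, rfl⟩ := exists_hermitianOf_eq hP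
  -- With `A = P * V`, if `V * U` were a short circuit then `A * U = P * (V * U)` would lie in the
  -- range; translation by `V` costs nothing.
  rw [← eventually_mul_left_iff (haarUnitary n d) ⟨V, hV⟩]
  filter_upwards [hA] with U hU M hM
  refine hU ⟨(B, M), ?_⟩
  change hermitianOf B * opProduct e M * 1 = Matrix.of A * (U : Matrix (Idx n d) (Idx n d) ℂ)
  rw [hM, hAPV, mul_one, mul_assoc]
  rfl

/-- The constant in the lower bounds. -/
noncomputable def lowerConst (d : ℕ) : ℝ≥0 := 1 / (2 * d ^ 4)

theorem two_mul_lt_of_lt_lowerConst (hd : 2 ≤ d) {m N : ℕ}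
    (h : (m : ℝ≥0∞) < lowerConst d * (N : ℝ≥0∞)) : 2 * m * d ^ 4 < N := by
  have hd' : (0 : ℝ≥0) < 2 * d ^ 4 := by positivity
  have h1 : (m : ℝ≥0) < lowerConst d * N := by exact_mod_cast h
  rw [lowerConst, one_div, inv_mul_eq_div, lt_div_iff₀ hd'] at h1
  have h2 : m * (2 * d ^ 4) < N := by exact_mod_cast h1
  linarith

/-- The infimum lives in `ℕ∞`, so the real bound is first rounded up to an integer. -/
theorem le_toENNReal_iInf {ι : Type*} {p : ι → Prop} {l : ι → ℕ} {a : ℝ≥0}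
    (h : ∀ i, p i → (a : ℝ≥0∞) ≤ (l i : ℝ≥0∞)) :
    (a : ℝ≥0∞) ≤ ((⨅ (i : ι) (_ : p i), (l i : ℕ∞) : ℕ∞) : ℝ≥0∞) := by
  have h1 : ((⌈a⌉₊ : ℕ) : ℕ∞) ≤ ⨅ (i : ι) (_ : p i), (l i : ℕ∞) := by
    refine le_iInf₂ fun i hi => ?_
    have : a ≤ (l i : ℝ≥0) := by exact_mod_cast h i hi
    exact_mod_cast Nat.ceil_le.mpr this
  have h2 : (((⌈a⌉₊ : ℕ) : ℕ∞) : ℝ≥0∞) ≤ _ := ENat.toENNReal_le.mpr h1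
  refine le_trans ?_ h2
  rw [ENat.toENNReal_coe]
  exact_mod_cast Nat.le_ceil a

theorem ae_le_stateComplexity (hd : 2 ≤ d) (G : SimpleGraph (Fin n)) :
    ∀ᵐ (ψ : Metric.sphere (0 : StateSpace n d) 1) ∂(sphereMeasure n d),
      lowerConst d * (d : ℝ≥0∞) ^ n ≤ (stateComplexity G ψ : ℝ≥0∞) := by
  have h : ∀ᵐ (ψ : Metric.sphere (0 : StateSpace n d) 1) ∂(sphereMeasure n d), ∀ (m : ℕ) (e : Fin m → Fin n × Fin n),
      2 * m * d ^ 4 + 1 < 2 * d ^ n → ∀ M : GateParams d m,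
        opProduct e M *ᵥ zeroKet n d ≠ (ψ : StateSpace n d).ofLp :=
    ae_all_iff.mpr fun m => ae_all_iff.mpr fun e => by
      by_cases hm : 2 * m * d ^ 4 + 1 < 2 * d ^ n
      · simpa [hm] using ae_opProduct_ne_state hm e
      · simp [hm]
  filter_upwards [h] with ψ hψ
  have := le_toENNReal_iInf (a := lowerConst d * (d : ℝ≥0) ^ n)
    (p := fun c : Circuit G d => c.toMatrix *ᵥ zeroKet n d = (ψ : StateSpace n d).ofLp)
    (l := List.length) fun c hc => ?_
  · simpa [stateComplexity] using this
  · by_contra hlt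
    rw [not_le] at hlt
    have hm := two_mul_lt_of_lt_lowerConst (m := c.length) (N := d ^ n) hd (by simpa using hlt)
    obtain ⟨e, M, heM⟩ := c.exists_opProduct_eq
    exact hψ _ e (by omega) M (by rw [heM, hc])

theorem ae_le_unitaryComplexity (hd : 2 ≤ d) (G : SimpleGraph (Fin n)) :
    ∀ᵐ (U : Matrix.unitaryGroup (Idx n d) ℂ) ∂(haarUnitary n d),
      lowerConst d * (d : ℝ≥0∞) ^ (2 * n) ≤ (unitaryComplexity G U : ℝ≥0∞) := by
  have h : ∀ᵐ (U : Matrix.unitaryGroup (Idx n d) ℂ) ∂(haarUnitary n d), ∀ (m : ℕ) (e : Fin m → Fin n × Fin n),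
      2 * m * d ^ 4 < d ^ (2 * n) → ∀ M : GateParams d m,
        opProduct e M ≠ (U : Matrix (Idx n d) (Idx n d) ℂ) :=
    ae_all_iff.mpr fun m => ae_all_iff.mpr fun e => by
      by_cases hm : 2 * m * d ^ 4 < d ^ (2 * n)
      · simpa [hm] using ae_opProduct_ne_unitary hm e
      · simp [hm]
  filter_upwards [h] with U hU
  have := le_toENNReal_iInf (a := lowerConst d * (d : ℝ≥0) ^ (2 * n))
    (p := fun c : Circuit G d => c.toMatrix = (U : Matrix (Idx n d) (Idx n d) ℂ))
    (l := List.length) fun c hc => ?_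
  · simpa [unitaryComplexity] using this
  · by_contra hlt
    rw [not_le] at hlt
    have hm := two_mul_lt_of_lt_lowerConst (m := c.length) (N := d ^ (2 * n)) hd
      (by simpa using hlt)
    obtain ⟨e, M, heM⟩ := c.exists_opProduct_eq
    exact hU _ e hm M (by rw [heM, hc])

end LowerBounds

end QuditChain


open QuditChain in
theorem mainTheorem2 (d : ℕ) (hd : 2 ≤ d) :
    (∃ c C : ℝ≥0, 0 < c ∧ ∀ n : ℕ, 2 ≤ n → ∀ G : SimpleGraph (Fin n),
      (SimpleGraph.pathGraph n).IsContained G →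
        (∀ ψ : Metric.sphere (0 : StateSpace n d) 1,
          (stateComplexity G ψ : ℝ≥0∞) ≤ C * (d : ℝ≥0∞) ^ n) ∧
        (∀ᵐ ψ ∂(sphereMeasure n d),
          c * (d : ℝ≥0∞) ^ n ≤ (stateComplexity G ψ : ℝ≥0∞)) ∧
        (∀ U : Matrix.unitaryGroup (Idx n d) ℂ,
          (unitaryComplexity G U : ℝ≥0∞) ≤ C * (d : ℝ≥0∞) ^ (2 * n)) ∧
        (∀ᵐ U ∂(haarUnitary n d),
          c * (d : ℝ≥0∞) ^ (2 * n) ≤ (unitaryComplexity G U : ℝ≥0∞))) ∧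
    (∀ n : ℕ, clubCount d n 0 = n) ∧
    (∀ n k : ℕ, 1 ≤ k → k ≤ n - 1 → clubCount d n k = d ^ (n - k) - 1) ∧
    (∀ n k : ℕ, n ≤ k → clubCount d n k = 0) ∧
    (∃ K : ℕ, ∀ n : ℕ, ∑ k ∈ Finset.range n, k * clubCount d n k ≤ K * d ^ n) := by
  refine ⟨⟨lowerConst d, ((50 + 9 * d : ℕ) : ℝ≥0), ?_, fun n hn G hG =>
    ⟨fun ψ => ?_, ae_le_stateComplexity hd G, fun U => ?_, ae_le_unitaryComplexity hd G⟩⟩,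
    clubCount_formula hd⟩
  · have : 0 < d := by omega
    unfold lowerConst
    positivity
  · refine (ENat.toENNReal_le.mpr (stateComplexity_le hn hd hG ψ)).trans ?_
    rw [ENat.toENNReal_coe]
    exact_mod_cast Nat.mul_le_mul_right (d ^ n) (show 25 ≤ 50 + 9 * d by omega)
  · refine (ENat.toENNReal_le.mpr (unitaryComplexity_le hn hd hG U)).trans ?_
    rw [ENat.toENNReal_coe]
    exact_mod_cast le_rfl
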